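/- For $w>0$ let $f_w:[0,1]\to[0,1]$ be the Liverani--Saussol--Vaienti map, $f_w(x)=x(1+2^w x^w)$ for $x\in[0,\tfrac12)$ and $f_w(x)=2x-1$ for $x\in[\tfrac12,1]$. Let $0<\alpha<1$ and $\epsilon>0$, and let $\nu_{\alpha,\epsilon}$ be the probability measure on $[\alpha,\infty)$ with density $\epsilon\alpha^\epsilon t^{-(\epsilon+1)}$. Let $w_0,w_1,\dots$ be i.i.d. with law $\nu_{\alpha,\epsilon}$, and let $X_n=f_{w_{n-1}}\circ\dots\circ f_{w_0}(x)$; this is a Markov chain on $[0,1]$ started at $X_0=x$, whose law and expectation are denoted by $\mathbb P_x$ and $\mathbb E_x$, and whose $n$-step transition probabilities are $P^n(x,A)=\mathbb P_x(X_n\in A)$. For Borel $A\subset[0,1]$ let $\tau_A=\inf\{n\ge 1: X_n\in A\}$ (with $\inf\emptyset=\infty$). Let $0<b<\tfrac12$ satisfy $f_\alpha(b)>\tfrac{3+b}{4}$, and let $C=[f_\alpha^{-1}(b),b]$, where $f_\alpha^{-1}(b)$ is the preimage of $b$ under the left branch $f_\alpha|_{[0,1/2)}$. Then the following hold for every $1<\gamma<\tfrac1\alpha$.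 (i) $C$ is petite: there are a probability distribution $a$ on $\{1,2,\dots\}$ and a nonzero Borel measure $\mu$ with $\sum_{n\ge1}a(n)P^n(x,\cdot)\ge\mu$ for all $x\in C$. (ii) $\displaystyle\sup_{x\in C}\mathbb E_x\big[\tau_C^\gamma\big]<\infty.$ (iii) The function $r(n)=n^{\gamma-1}$ is a subgeometric rate function, i.e. there is a non-decreasing $r_0:\{0,1,2,\dots\}\to\mathbb R$ with $r_0(1)\ge2$, $\log(r_0(n))/n\to0$, $\liminf_n r(n)/r_0(n)>0$ and $\limsup_n r(n)/r_0(n)<\infty$; and $$\sup_{x\in C}\mathbb E_x\Big[\sum_{n=0}^{\tau_C-1}r(n)\Big]<\infty .$$ -/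

import Mathlib

open MeasureTheory ProbabilityTheory Filter Topology
open scoped ENNReal

noncomputable section

/-- The Liverani--Saussol--Vaienti map `f_w` with parameter `w`. Its domain is the unit interval,
which it maps to itself for `w > 0` (see `lsvMap_mem_Icc`); values at points outside the unit
interval are never used. -/
def lsvMap (w x : ℝ) : ℝ :=
  if x < 1 / 2 then x * (1 + (2 : ℝ) ^ w * x ^ w) else 2 * x - 1

theorem lsvMap_mem_Icc {w x : ℝ} (hw : 0 < w) (hx : x ∈ Set.Icc (0 : ℝ) 1) :
    lsvMap w x ∈ Set.Icc (0 : ℝ) 1 := by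
  obtain ⟨h0, h1⟩ := hx
  unfold lsvMap
  split_ifs with h
  · have e : (2 : ℝ) ^ w * x ^ w = (2 * x) ^ w := (Real.mul_rpow (by norm_num) h0).symm
    have h2 : (2 * x) ^ w ≤ 1 := Real.rpow_le_one (by linarith) (by linarith) hw.le
    have h3 : 0 ≤ (2 * x) ^ w := Real.rpow_nonneg (by linarith) w
    rw [e]
    constructor <;> nlinarith
  · constructor <;> linarith

/-- The law of the i.i.d. parameter sequence `(w_0, w_1, ...)`: the infinite product of the
Pareto law with density `ε α^ε / t^(ε+1)` on `[α, ∞)`. -/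
def paramLaw (α ε : ℝ) : Measure (ℕ → ℝ) :=
  Measure.infinitePi fun _ : ℕ => paretoMeasure α ε

/-- `chain w n x = f_{w_{n-1}} ∘ ... ∘ f_{w_0} (x)`. For `w` distributed according to
`paramLaw α ε`, this is the Markov chain `X_n` under `ℙ_x` (started at `X_0 = x`). -/
def chain (w : ℕ → ℝ) : ℕ → ℝ → ℝ
  | 0, x => x
  | n + 1, x => lsvMap (w n) (chain w n x)

/-- The first return (or hitting) time `inf {n ≥ 1 : X_n ∈ A}`, equal to `⊤` if there is no
such `n`. -/
def returnTime (A : Set ℝ) (w : ℕ → ℝ) (x : ℝ) : ℕ∞ :=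
  ⨅ (n : ℕ) (_ : 1 ≤ n ∧ chain w n x ∈ A), (n : ℕ∞)

/-- The `n`-step transition probability `P^n(x, A) = ℙ_x (X_n ∈ A)`. -/
def transProb (α ε : ℝ) (n : ℕ) (x : ℝ) (A : Set ℝ) : ℝ≥0∞ :=
  paramLaw α ε {w | chain w n x ∈ A}

/-- `C` is petite for the chain: for some probability distribution `a` on `{1, 2, ...}` and some
nonzero measure `μ`, `∑_n a(n) P^n(x, ·) ≥ μ` for every `x ∈ C`. -/
def IsPetite (α ε : ℝ) (C : Set ℝ) : Prop :=
  MeasurableSet C ∧ ∃ (a : ℕ → ℝ≥0∞) (μ : Measure ℝ), a 0 = 0 ∧ ∑' n, a n = 1 ∧ μ ≠ 0 ∧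
    ∀ x ∈ C, ∀ A : Set ℝ, MeasurableSet A → μ A ≤ ∑' n, a n * transProb α ε n x A

/-- Subgeometric rate functions. The lower and upper limits are taken in the extended reals. -/
def IsSubgeometricRate (r : ℕ → ℝ) : Prop :=
  ∃ r₀ : ℕ → ℝ, Monotone r₀ ∧ 2 ≤ r₀ 1 ∧
    Tendsto (fun n : ℕ => Real.log (r₀ n) / n) atTop (𝓝 0) ∧
    0 < liminf (fun n : ℕ => ((r n / r₀ n : ℝ) : EReal)) atTop ∧
    limsup (fun n : ℕ => ((r n / r₀ n : ℝ) : EReal)) atTop < ⊤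

/-- The sum `∑_{n=0}^{T-1} r(n)` for `r ≥ 0` and a possibly infinite `T`. -/
def sumUpTo (r : ℕ → ℝ) (T : ℕ∞) : ℝ≥0∞ :=
  ∑' n : ℕ, if (n : ℕ∞) < T then ENNReal.ofReal (r n) else 0

end

/-! ### Markov property and moments of the return time -/

/-! The return time is controlled by a Lyapunov function measured in the `L^γ` norm. After one step
`τ` equals `1` plus, when `X_1 ∉ C`, the return time of the shifted chain. By Minkowski's
inequality, any `U` with `1 + ‖1_{X_1 ∉ C} U(X_1)‖_γ ≤ U(x)` off `C` therefore bounds `‖τ‖_γ` there,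
and one more step bounds it on `C` (`lintegral_returnTime_le`).

The function `U` vanishes on `C = [c, b]` and has three other pieces, with a parameter `β` such that
`max (αγ) (1 - ε) < β < 1`. On `(0, c)`, `U = K x^(-β/γ)`. Parameters in `[α, β/γ]` have positive
probability and lower `U` by at least a constant, and `f_w ≤ f_α` with `f_α(c) = b` prevents a jump
over `C` (`lyapunov_drift_left`). On `(b, 1/2)`, `U^γ = A + s^(-β)` with `s = 1/2 - x`. With
probability at least some `p > 0` the next entry into `[0, 1/2)` lies in `[0, b]`, where `A` is not
paid (`exists_le_measure_leftEntry`). The singular part of `U^γ` at that entry has expectation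
`O(s^(-β'))` with `β' < β` (`exists_lintegral_endWeight_le`): `β < 1` makes the singularities
integrable, and the Pareto tail accounts for `1 - ε < β'`. A large `A` then closes the estimate
(`exists_lyapunov_const`). On `[1/2, 1)` the motion is deterministic doubling of the distance to
`1`; `U` adds the number of doublings to its value at the entry point. From `(b, 1/2)` that number
is only logarithmic in `1/s`.

Petiteness needs two steps: the first reaches a neighbourhood of `b` with uniformly positive
probability, the second has a density bounded below on `[1/2, 3/4]`. The rate statement follows from
the moment bound because the sum of `n^(γ-1)` over `n < τ` is at most `τ^γ`. -/

/-- Prepend a value to a sequence. -/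
def consSeq (a : ℝ) (w : ℕ → ℝ) : ℕ → ℝ
  | 0 => a
  | n + 1 => w n

theorem measurable_consSeq : Measurable fun p : ℝ × (ℕ → ℝ) => consSeq p.1 p.2 := by
  refine measurable_pi_lambda _ fun n => ?_
  cases n with
  | zero => exact measurable_fst
  | succ n => exact (measurable_pi_apply n).comp measurable_snd

theorem ae_le_paretoMeasure (α ε : ℝ) : ∀ᵐ a ∂(paretoMeasure α ε), α ≤ a := by
  have hm : Measurable (paretoPDF α ε) := (measurable_paretoPDFReal α ε).ennreal_ofReal
  rw [paretoMeasure, ae_withDensity_iff hm]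
  refine ae_of_all _ fun a ha => ?_
  by_contra h
  exact ha (paretoPDF_of_lt (not_le.1 h))

-- This is the source of the Markov property: after the first parameter is split off, the rest is
-- independent of it and has the same law. A product measure is determined by its finite-dimensional
-- boxes, so only these are compared.
open scoped Classical in
theorem paramLaw_eq_map {α ε : ℝ} (hα : 0 < α) (hε : 0 < ε) :
    paramLaw α ε = ((paretoMeasure α ε).prod (paramLaw α ε)).map
      fun p => consSeq p.1 p.2 := by
  have : IsProbabilityMeasure (paretoMeasure α ε) := isProbabilityMeasure_paretoMeasure hα hε
  have : IsProbabilityMeasure (paramLaw α ε) := by unfold paramLaw; infer_instance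
  symm
  refine Measure.eq_infinitePi _ fun s t ht => ?_
  have hpre : (fun p : ℝ × (ℕ → ℝ) => consSeq p.1 p.2) ⁻¹' (Set.pi s t) =
      (if 0 ∈ s then t 0 else Set.univ) ×ˢ
        (Set.pi (s.preimage Nat.succ Nat.succ_injective.injOn : Finset ℕ)
          fun n => t (n + 1)) := by
    ext ⟨a, w⟩
    simp only [Set.mem_preimage, Set.mem_pi, Finset.mem_coe, Set.mem_prod, Finset.mem_preimage]
    constructor
    · intro h
      refine ⟨?_, fun n hn => h _ hn⟩
      split_ifs with h0
      · exact h 0 h0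
      · trivial
    · rintro ⟨h0, h⟩ n hn
      cases n with
      | zero => rw [if_pos hn] at h0; exact h0
      | succ n => exact h n hn
  rw [Measure.map_apply measurable_consSeq (MeasurableSet.pi s.countable_toSet fun i _ => ht i),
    hpre, Measure.prod_prod]
  have h2 : paramLaw α ε (Set.pi (s.preimage Nat.succ Nat.succ_injective.injOn : Finset ℕ)
      fun n => t (n + 1)) = ∏ i ∈ s.preimage Nat.succ Nat.succ_injective.injOn,
        paretoMeasure α ε (t (i + 1)) :=
    Measure.infinitePi_pi (fun _ => paretoMeasure α ε) fun i _ => ht (i + 1)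
  rw [h2, Finset.prod_preimage' Nat.succ s Nat.succ_injective.injOn
    fun i => paretoMeasure α ε (t i)]
  have hr : ∀ i, i ∈ Set.range Nat.succ ↔ i ≠ 0 := by
    intro i
    simp [Nat.range_succ, Nat.pos_iff_ne_zero]
  split_ifs with h0
  · rw [← Finset.mul_prod_erase s _ h0]
    congr 1
    refine Finset.prod_congr ?_ fun _ _ => rfl
    ext i
    rw [Finset.mem_filter, Finset.mem_erase, hr, and_comm]
  · rw [measure_univ, one_mul]
    refine Finset.prod_congr ?_ fun _ _ => rfl
    ext i
    rw [Finset.mem_filter, hr]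
    exact ⟨fun h => h.1, fun h => ⟨h, fun hi => h0 (hi ▸ h)⟩⟩

theorem lintegral_paramLaw {α ε : ℝ} (hα : 0 < α) (hε : 0 < ε) {F : (ℕ → ℝ) → ℝ≥0∞}
    (hF : Measurable F) :
    ∫⁻ w, F w ∂(paramLaw α ε) =
      ∫⁻ a, ∫⁻ w, F (consSeq a w) ∂(paramLaw α ε) ∂(paretoMeasure α ε) := by
  have : IsProbabilityMeasure (paretoMeasure α ε) := isProbabilityMeasure_paretoMeasure hα hε
  have : IsProbabilityMeasure (paramLaw α ε) := by unfold paramLaw; infer_instance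
  conv_lhs => rw [paramLaw_eq_map hα hε]
  rw [lintegral_map hF measurable_consSeq,
    lintegral_prod (fun p : ℝ × (ℕ → ℝ) => F (consSeq p.1 p.2))
      (hF.comp measurable_consSeq).aemeasurable]

theorem measurable_lsvMap : Measurable fun p : ℝ × ℝ => lsvMap p.1 p.2 := by
  unfold lsvMap
  refine Measurable.ite (measurableSet_lt measurable_snd measurable_const) ?_ ?_ <;> fun_prop

theorem Measurable.lsvMap {X : Type*} [MeasurableSpace X] {f g : X → ℝ} (hf : Measurable f)
    (hg : Measurable g) : Measurable fun z => lsvMap (f z) (g z) :=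
  measurable_lsvMap.comp (hf.prodMk hg)

theorem measurable_chain (n : ℕ) : Measurable fun p : (ℕ → ℝ) × ℝ => chain p.1 n p.2 := by
  induction n with
  | zero => exact measurable_snd
  | succ n ih =>
    exact ((measurable_pi_apply n).comp measurable_fst).lsvMap ih

theorem chain_succ' (w : ℕ → ℝ) (n : ℕ) (x : ℝ) :
    chain w (n + 1) x = chain (fun k => w (k + 1)) n (lsvMap (w 0) x) := by
  induction n with
  | zero => rfl
  | succ n ih => rw [chain, ih]; rfl

/-- The return time to `C`, truncated at `n`. -/
noncomputable def truncTime (C : Set ℝ) : ℕ → (ℕ → ℝ) → ℝ → ℝ≥0∞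
  | 0, _, _ => 0
  | n + 1, w, x => 1 + Cᶜ.indicator (truncTime C n fun k => w (k + 1)) (lsvMap (w 0) x)

theorem measurable_truncTime {C : Set ℝ} (hC : MeasurableSet C) (n : ℕ) :
    Measurable fun p : (ℕ → ℝ) × ℝ => truncTime C n p.1 p.2 := by
  induction n with
  | zero => exact measurable_const
  | succ n ih =>
    have h1 : Measurable fun p : (ℕ → ℝ) × ℝ => lsvMap (p.1 0) p.2 :=
      ((measurable_pi_apply 0).comp measurable_fst).lsvMap measurable_snd
    have h2 : Measurable fun p : (ℕ → ℝ) × ℝ => fun k => p.1 (k + 1) :=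
      measurable_pi_lambda _ fun k => (measurable_pi_apply (k + 1)).comp measurable_fst
    have h3 : (fun p : (ℕ → ℝ) × ℝ => truncTime C (n + 1) p.1 p.2) = fun p =>
        1 + {p : (ℕ → ℝ) × ℝ | lsvMap (p.1 0) p.2 ∈ Cᶜ}.indicator
          (fun p => truncTime C n (fun k => p.1 (k + 1)) (lsvMap (p.1 0) p.2)) p := by
      funext p
      simp only [truncTime, Set.indicator]
      rfl
    rw [h3]
    exact measurable_const.add ((ih.comp (h2.prodMk h1)).indicator (h1 hC.compl))

theorem truncTime_mono_succ (C : Set ℝ) (n : ℕ) (w : ℕ → ℝ) (x : ℝ) :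
    truncTime C n w x ≤ truncTime C (n + 1) w x := by
  induction n generalizing w x with
  | zero => exact zero_le
  | succ n ih =>
    rw [truncTime, truncTime]
    gcongr
    exact ih _ _

/-- This dichotomy is all that is needed to compare the truncations with the return time: either a
visit has occurred by the recorded time, or the truncation is saturated. -/
theorem truncTime_hit_or (C : Set ℝ) (n : ℕ) (w : ℕ → ℝ) (x : ℝ) :
    (∃ m : ℕ, 1 ≤ m ∧ (m : ℝ≥0∞) ≤ truncTime C n w x ∧ chain w m x ∈ C) ∨
      truncTime C n w x = n := by
  induction n generalizing w x with
  | zero => right; simp [truncTime]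
  | succ n ih =>
    by_cases h : lsvMap (w 0) x ∈ C
    · left
      exact ⟨1, le_rfl, by simp [truncTime], h⟩
    · have e : truncTime C (n + 1) w x =
          1 + truncTime C n (fun k => w (k + 1)) (lsvMap (w 0) x) := by
        rw [truncTime, Set.indicator_of_mem h]
      rcases ih (fun k => w (k + 1)) (lsvMap (w 0) x) with ⟨m, h1, h2, h3⟩ | h1
      · left
        refine ⟨m + 1, by omega, ?_, ?_⟩
        · rw [e]; push_cast; rw [add_comm]; gcongr
        · rw [chain_succ']; exact h3
      · right
        rw [e, h1]; push_cast; rw [add_comm]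

theorem returnTime_le_iSup_truncTime (C : Set ℝ) (w : ℕ → ℝ) (x : ℝ) :
    ((returnTime C w x : ℕ∞) : ℝ≥0∞) ≤ ⨆ n, truncTime C n w x := by
  by_cases h : ∀ n, truncTime C n w x = n
  · simp only [h]
    rw [ENNReal.iSup_natCast]
    exact le_top
  · push Not at h
    obtain ⟨n, hn⟩ := h
    rcases truncTime_hit_or C n w x with ⟨m, h1, h2, h3⟩ | h1
    · refine le_trans ?_ (h2.trans (le_iSup (fun n => truncTime C n w x) n))
      have : returnTime C w x ≤ (m : ℕ∞) := iInf₂_le m ⟨h1, h3⟩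
      calc ((returnTime C w x : ℕ∞) : ℝ≥0∞) ≤ ((m : ℕ∞) : ℝ≥0∞) := by
            exact ENat.toENNReal_le.2 this
        _ = m := by simp
    · exact absurd h1 hn

/-! ### Drift condition in the `L^γ` norm -/

section Drift

variable {α ε γ : ℝ} {C : Set ℝ}

/-- Minkowski's inequality for the splitting into the first step and the remaining time; the Markov
property turns the second norm into an integral over the first parameter. -/
theorem lintegral_truncTime_succ_le (hα : 0 < α) (hε : 0 < ε) (hγ : 1 ≤ γ)
    (hC : MeasurableSet C) (n : ℕ) (x : ℝ) :
    (∫⁻ w, truncTime C (n + 1) w x ^ γ ∂(paramLaw α ε)) ^ (1 / γ) ≤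
      1 + (∫⁻ a, Cᶜ.indicator (fun y => ∫⁻ w, truncTime C n w y ^ γ ∂(paramLaw α ε))
        (lsvMap a x) ∂(paretoMeasure α ε)) ^ (1 / γ) := by
  have hγ0 : 0 < γ := by linarith
  have : IsProbabilityMeasure (paretoMeasure α ε) := isProbabilityMeasure_paretoMeasure hα hε
  have : IsProbabilityMeasure (paramLaw α ε) := by unfold paramLaw; infer_instance
  have hx : Measurable fun w : ℕ → ℝ => lsvMap (w 0) x :=
    (measurable_pi_apply 0).lsvMap measurable_const
  have h2 : Measurable fun w : ℕ → ℝ => fun k => w (k + 1) :=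
    measurable_pi_lambda _ fun k => measurable_pi_apply (k + 1)
  have hm : Measurable fun w : ℕ → ℝ =>
      Cᶜ.indicator (truncTime C n fun k => w (k + 1)) (lsvMap (w 0) x) := by
    have : (fun w : ℕ → ℝ =>
        Cᶜ.indicator (truncTime C n fun k => w (k + 1)) (lsvMap (w 0) x)) =
        {w : ℕ → ℝ | lsvMap (w 0) x ∈ Cᶜ}.indicator
          fun w => truncTime C n (fun k => w (k + 1)) (lsvMap (w 0) x) := by
      funext w
      simp only [Set.indicator]
      rfl
    rw [this]
    exact ((measurable_truncTime hC n).comp (h2.prodMk hx)).indicator (hx hC.compl)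
  refine (ENNReal.lintegral_Lp_add_le (f := fun _ => 1) aemeasurable_const hm.aemeasurable
    hγ).trans ?_
  simp only [ENNReal.one_rpow, lintegral_const, measure_univ, mul_one]
  gcongr 1 + ?_ ^ (1 / γ)
  rw [lintegral_paramLaw hα hε (hm.pow_const γ)]
  refine lintegral_mono fun a => ?_
  simp only [consSeq]
  by_cases h : lsvMap a x ∈ Cᶜ
  · simp only [Set.indicator_of_mem h]; rfl
  · simp [Set.indicator_of_notMem h, hγ0]

/-- Moments of the return time from a Lyapunov function `U`. -/
theorem lintegral_truncTime_le (hα : 0 < α) (hε : 0 < ε) (hγ : 1 ≤ γ) (hC : MeasurableSet C)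
    {U : ℝ → ℝ≥0∞}
    (hU : ∀ x ∈ Set.Icc (0 : ℝ) 1, x ∉ C →
      1 + (∫⁻ a, Cᶜ.indicator (fun y => U y ^ γ) (lsvMap a x) ∂(paretoMeasure α ε)) ^ (1 / γ)
        ≤ U x) (n : ℕ) {x : ℝ} (hx : x ∈ Set.Icc (0 : ℝ) 1) (hxC : x ∉ C) :
    ∫⁻ w, truncTime C n w x ^ γ ∂(paramLaw α ε) ≤ U x ^ γ := by
  have hγ0 : 0 < γ := by linarith
  induction n generalizing x with
  | zero => simp [truncTime, hγ0]
  | succ n ih =>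
    have h1 := (lintegral_truncTime_succ_le hα hε hγ hC n x).trans
      ((add_le_add_right (ENNReal.rpow_le_rpow (lintegral_mono_ae ?_) (by positivity)) 1).trans
        (hU x hx hxC))
    · rw [one_div] at h1
      exact (ENNReal.rpow_inv_le_iff hγ0).1 h1
    · filter_upwards [ae_le_paretoMeasure α ε] with a ha
      by_cases h : lsvMap a x ∈ Cᶜ
      · simp only [Set.indicator_of_mem h]
        exact ih (lsvMap_mem_Icc (hα.trans_le ha) hx) h
      · simp [Set.indicator_of_notMem h]

/-- The starting point may lie in `C`, where no drift is assumed: after one free step the chain is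
in `C` or at a point where the drift bound applies. Monotone convergence removes the truncation. -/
theorem lintegral_returnTime_le (hα : 0 < α) (hε : 0 < ε) (hγ : 1 ≤ γ) (hC : MeasurableSet C)
    {U : ℝ → ℝ≥0∞}
    (hU : ∀ x ∈ Set.Icc (0 : ℝ) 1, x ∉ C →
      1 + (∫⁻ a, Cᶜ.indicator (fun y => U y ^ γ) (lsvMap a x) ∂(paretoMeasure α ε)) ^ (1 / γ)
        ≤ U x) {x : ℝ} (hx : x ∈ Set.Icc (0 : ℝ) 1) :
    ∫⁻ w, ((returnTime C w x : ℕ∞) : ℝ≥0∞) ^ γ ∂(paramLaw α ε) ≤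
      (1 + (∫⁻ a, Cᶜ.indicator (fun y => U y ^ γ) (lsvMap a x) ∂(paretoMeasure α ε)) ^ (1 / γ))
        ^ γ := by
  have hγ0 : 0 < γ := by linarith
  have hmono : Monotone fun n w => truncTime C n w x :=
    monotone_nat_of_le_succ fun n w => truncTime_mono_succ C n w x
  have hmeas : ∀ n, Measurable fun w => truncTime C n w x := fun n =>
    (measurable_truncTime hC n).comp (measurable_id.prodMk measurable_const)
  calc ∫⁻ w, ((returnTime C w x : ℕ∞) : ℝ≥0∞) ^ γ ∂(paramLaw α ε)
      ≤ ∫⁻ w, ⨆ n, truncTime C n w x ^ γ ∂(paramLaw α ε) := by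
        refine lintegral_mono fun w => ?_
        refine (ENNReal.rpow_le_rpow (returnTime_le_iSup_truncTime C w x) hγ0.le).trans ?_
        exact ((ENNReal.orderIsoRpow γ hγ0).map_iSup fun n => truncTime C n w x).le
    _ = ⨆ n, ∫⁻ w, truncTime C n w x ^ γ ∂(paramLaw α ε) :=
        lintegral_iSup (fun n => (hmeas n).pow_const γ)
          fun i j hij w => ENNReal.rpow_le_rpow (hmono hij w) hγ0.le
    _ ≤ _ := iSup_le fun n => by
        refine (lintegral_mono fun w =>
          ENNReal.rpow_le_rpow (truncTime_mono_succ C n w x) hγ0.le).trans ?_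
        rw [← ENNReal.rpow_inv_le_iff hγ0, ← one_div]
        refine (lintegral_truncTime_succ_le hα hε hγ hC n x).trans ?_
        refine add_le_add_right (ENNReal.rpow_le_rpow (lintegral_mono_ae ?_) (by positivity)) 1
        filter_upwards [ae_le_paretoMeasure α ε] with a ha
        by_cases h : lsvMap a x ∈ Cᶜ
        · simp only [Set.indicator_of_mem h]
          exact lintegral_truncTime_le hα hε hγ hC hU n (lsvMap_mem_Icc (hα.trans_le ha) hx) h
        · simp [Set.indicator_of_notMem h]

end Drift

/-! ### The one-step law on the left branch -/

theorem lsvMap_of_lt {w x : ℝ} (h0 : 0 ≤ x) (h : x < 1 / 2) :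
    lsvMap w x = x + x * (2 * x) ^ w := by
  rw [lsvMap, if_pos h, ← Real.mul_rpow (by norm_num) h0]
  ring

theorem lsvMap_of_ge {w x : ℝ} (h : 1 / 2 ≤ x) : lsvMap w x = 2 * x - 1 := by
  rw [lsvMap, if_neg (not_lt.2 h)]

theorem neg_log_two_mul_pos {x : ℝ} (h0 : 0 < x) (h : x < 1 / 2) : 0 < -Real.log (2 * x) :=
  neg_pos.2 (Real.log_neg (by linarith) (by linarith))

theorem lt_lsvMap {w x : ℝ} (h0 : 0 < x) (h : x < 1 / 2) : x < lsvMap w x := by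
  rw [lsvMap_of_lt h0.le h]
  have : 0 < x * (2 * x) ^ w := mul_pos h0 (Real.rpow_pos_of_pos (by linarith) w)
  linarith

theorem lsvMap_anti_left {a w x : ℝ} (h0 : 0 < x) (h : x < 1 / 2) (haw : a ≤ w) :
    lsvMap w x ≤ lsvMap a x := by
  rw [lsvMap_of_lt h0.le h, lsvMap_of_lt h0.le h]
  have := Real.rpow_le_rpow_of_exponent_ge (by linarith : 0 < 2 * x) (by linarith) haw
  nlinarith

theorem lsvMap_lt_lsvMap {w x y : ℝ} (hw : 0 < w) (h0 : 0 ≤ x) (hxy : x < y) (h : y < 1 / 2) :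
    lsvMap w x < lsvMap w y := by
  rw [lsvMap_of_lt h0 (hxy.trans h), lsvMap_of_lt (h0.trans hxy.le) h]
  have h1 := Real.rpow_le_rpow (by linarith : 0 ≤ 2 * x) (by linarith : 2 * x ≤ 2 * y) hw.le
  have h2 : 0 ≤ (2 * x) ^ w := Real.rpow_nonneg (by linarith) w
  nlinarith

theorem lsvMap_lt_two_mul {w x : ℝ} (hw : 0 < w) (h0 : 0 < x) (h : x < 1 / 2) :
    lsvMap w x < 2 * x := by
  rw [lsvMap_of_lt h0.le h]
  have := Real.rpow_lt_one (by linarith : 0 ≤ 2 * x) (by linarith) hw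
  nlinarith

/-- The equation `x + x (2x)^w = y` is solved for `w` by a logarithm to base `2x < 1`. The strict
version places `w` inside the support of the parameter law, so that it has neighbourhoods of
positive mass. -/
theorem exists_lsvMap_eq {α x y : ℝ} (h0 : 0 < x) (h : x < 1 / 2) (hxy : x < y) :
    (y ≤ lsvMap α x → ∃ w, α ≤ w ∧ lsvMap w x = y) ∧
      (y < lsvMap α x → ∃ w, α < w ∧ lsvMap w x = y) := by
  have hq : 0 < (y - x) / x := div_pos (by linarith) h0
  have e : (2 * x) ^ Real.logb (2 * x) ((y - x) / x) = (y - x) / x :=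
    Real.rpow_logb (by linarith) (by linarith) hq
  have e2 : lsvMap (Real.logb (2 * x) ((y - x) / x)) x = y := by
    rw [lsvMap_of_lt h0.le h, e]; field_simp; ring
  constructor
  · intro hy
    refine ⟨_, ?_, e2⟩
    by_contra! hlt
    have := Real.rpow_lt_rpow_of_exponent_gt (by linarith : 0 < 2 * x) (by linarith) hlt
    rw [lsvMap_of_lt h0.le h] at hy e2
    nlinarith
  · intro hy
    refine ⟨_, ?_, e2⟩
    by_contra! hlt
    exact absurd (lsvMap_anti_left h0 h hlt) (by rw [e2]; exact not_le.2 hy)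

theorem hasDerivAt_lsvMap {x : ℝ} (h0 : 0 < x) (h : x < 1 / 2) (w : ℝ) :
    HasDerivAt (fun w => lsvMap w x) ((lsvMap w x - x) * Real.log (2 * x)) w := by
  have e : (fun w => lsvMap w x) = fun w => x + x * (2 * x) ^ w := by
    funext w; exact lsvMap_of_lt h0.le h
  have h1 : HasDerivAt (fun w : ℝ => (2 * x) ^ w) (Real.log (2 * x) * (2 * x) ^ w) w := by
    simpa using (hasDerivAt_id w).const_rpow (by linarith : 0 < 2 * x)
  rw [e, lsvMap_of_lt h0.le h]
  refine ((h1.const_mul x).const_add x).congr_deriv ?_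
  ring

theorem injective_lsvMap_left {x : ℝ} (h0 : 0 < x) (h : x < 1 / 2) :
    Function.Injective fun w => lsvMap w x := by
  intro a b hab
  simp only [lsvMap_of_lt h0.le h] at hab
  have h1 : (2 * x) ^ a = (2 * x) ^ b := by
    have := add_left_cancel hab
    exact mul_left_cancel₀ h0.ne' this
  have h2 := congrArg Real.log h1
  rw [Real.log_rpow (by linarith), Real.log_rpow (by linarith)] at h2
  exact mul_right_cancel₀ (neg_pos.1 (neg_log_two_mul_pos h0 h)).ne h2

theorem lintegral_image_lsvMap {x : ℝ} (h0 : 0 < x) (h : x < 1 / 2) {s : Set ℝ}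
    (hs : MeasurableSet s) (F : ℝ → ℝ≥0∞) :
    ∫⁻ y in (fun w => lsvMap w x) '' s, F y =
      ∫⁻ w in s, ENNReal.ofReal ((lsvMap w x - x) * -Real.log (2 * x)) * F (lsvMap w x) := by
  rw [lintegral_image_eq_lintegral_abs_deriv_mul hs
    (fun w _ => (hasDerivAt_lsvMap h0 h w).hasDerivWithinAt) (injective_lsvMap_left h0 h).injOn]
  refine lintegral_congr fun w => ?_
  rw [abs_mul, abs_of_pos (sub_pos.2 (lt_lsvMap h0 h)),
    abs_of_neg (neg_pos.1 (neg_log_two_mul_pos h0 h))]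

variable {α ε : ℝ}

theorem measurable_lsvMap_left (x : ℝ) : Measurable fun w => lsvMap w x :=
  measurable_id.lsvMap measurable_const

/-- If the law of `f_w(x)` has density at most `κ` on `I`, expectations over `I` are bounded by
`κ` times Lebesgue integrals. -/
theorem lintegral_lsvMap_le {x κ : ℝ} (h0 : 0 < x) (h : x < 1 / 2) (hκ : 0 ≤ κ)
    {I : Set ℝ} (hI : MeasurableSet I) {F : ℝ → ℝ≥0∞} (hF : Measurable F)
    (hd : ∀ w, α ≤ w → lsvMap w x ∈ I →
      paretoPDFReal α ε w ≤ κ * ((lsvMap w x - x) * -Real.log (2 * x))) :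
    ∫⁻ a, I.indicator F (lsvMap a x) ∂(paretoMeasure α ε) ≤
      ENNReal.ofReal κ * ∫⁻ y in I, F y := by
  have hm := measurable_lsvMap_left x
  have hpdf : Measurable (paretoPDF α ε) := (measurable_paretoPDFReal α ε).ennreal_ofReal
  have hs : MeasurableSet {w | α ≤ w ∧ lsvMap w x ∈ I} := measurableSet_Ici.inter (hm hI)
  rw [paretoMeasure]
  calc _ = ∫⁻ w, (paretoPDF α ε * (I.indicator F ∘ fun w => lsvMap w x)) w :=
        lintegral_withDensity_eq_lintegral_mul _ hpdf ((hF.indicator hI).comp hm)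
    _ ≤ ∫⁻ w in {w | α ≤ w ∧ lsvMap w x ∈ I}, ENNReal.ofReal κ *
        (ENNReal.ofReal ((lsvMap w x - x) * -Real.log (2 * x)) * F (lsvMap w x)) := by
        rw [← lintegral_indicator hs]
        refine lintegral_mono fun w => ?_
        simp only [Pi.mul_apply, Function.comp_apply]
        by_cases h1 : α ≤ w
        · by_cases h2 : lsvMap w x ∈ I
          · rw [Set.indicator_of_mem (show w ∈ {w | α ≤ w ∧ lsvMap w x ∈ I} from ⟨h1, h2⟩),
              Set.indicator_of_mem h2, ← mul_assoc, ← ENNReal.ofReal_mul hκ]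
            gcongr
            exact ENNReal.ofReal_le_ofReal (hd w h1 h2)
          · simp [Set.indicator_of_notMem h2]
        · simp [paretoPDF_of_lt (not_le.1 h1)]
    _ = ENNReal.ofReal κ * ∫⁻ y in (fun w => lsvMap w x) '' {w | α ≤ w ∧ lsvMap w x ∈ I}, F y := by
        rw [lintegral_image_lsvMap h0 h hs, lintegral_const_mul' _ _ ENNReal.ofReal_ne_top]
    _ ≤ _ := by
        gcongr
        rintro _ ⟨w, hw, rfl⟩
        exact hw.2

/-- If the law of `f_w(x)` has density at least `1 / κ` on `J`, it dominates Lebesgue measure. -/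
theorem volume_le_lsvMap {x κ : ℝ} (h0 : 0 < x) (h : x < 1 / 2) (hκ : 0 ≤ κ)
    {J : Set ℝ} (hJ : MeasurableSet J) (hJx : ∀ y ∈ J, x < y ∧ y ≤ lsvMap α x)
    (hd : ∀ w, α ≤ w → lsvMap w x ∈ J →
      (lsvMap w x - x) * -Real.log (2 * x) ≤ κ * paretoPDFReal α ε w) :
    volume J ≤ ENNReal.ofReal κ * paretoMeasure α ε {a | lsvMap a x ∈ J} := by
  have hm := measurable_lsvMap_left x
  have hs : MeasurableSet {w | α ≤ w ∧ lsvMap w x ∈ J} := measurableSet_Ici.inter (hm hJ)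
  have himg : (fun w => lsvMap w x) '' {w | α ≤ w ∧ lsvMap w x ∈ J} = J := by
    ext y
    constructor
    · rintro ⟨w, hw, rfl⟩
      exact hw.2
    · intro hy
      obtain ⟨w, hw, rfl⟩ := (exists_lsvMap_eq h0 h (hJx y hy).1).1 (hJx y hy).2
      exact ⟨w, ⟨hw, hy⟩, rfl⟩
  calc volume J = ∫⁻ y in (fun w => lsvMap w x) '' {w | α ≤ w ∧ lsvMap w x ∈ J}, 1 := by
        rw [himg, setLIntegral_one]
    _ ≤ ∫⁻ w in {w | α ≤ w ∧ lsvMap w x ∈ J}, ENNReal.ofReal κ * paretoPDF α ε w := by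
        rw [lintegral_image_lsvMap h0 h hs]
        refine setLIntegral_mono' hs fun w hw => ?_
        rw [mul_one, paretoPDF, ← ENNReal.ofReal_mul hκ]
        exact ENNReal.ofReal_le_ofReal (hd w hw.1 hw.2)
    _ = ENNReal.ofReal κ * paretoMeasure α ε {w | α ≤ w ∧ lsvMap w x ∈ J} := by
        rw [lintegral_const_mul' _ _ ENNReal.ofReal_ne_top, paretoMeasure,
          withDensity_apply _ hs]
    _ ≤ _ := by
        gcongr
        exact fun h => h.2

theorem paretoMeasure_Ioo_pos (hα : 0 < α) (hε : 0 < ε) {u v : ℝ} (hu : α ≤ u) (huv : u < v) :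
    0 < paretoMeasure α ε (Set.Ioo u v) := by
  have hpdf : Measurable (paretoPDF α ε) := (measurable_paretoPDFReal α ε).ennreal_ofReal
  rw [paretoMeasure, withDensity_apply _ measurableSet_Ioo,
    setLIntegral_pos_iff hpdf]
  have : Set.Ioo u v ⊆ Function.support (paretoPDF α ε) := fun a ha => by
    have := paretoPDFReal_pos hα hε (hu.trans ha.1.le)
    simp [paretoPDF, this]
  rw [Set.inter_eq_self_of_subset_right this, Real.volume_Ioo]
  simpa using huv

theorem continuousAt_lsvMap {w x : ℝ} (h0 : 0 < x) (h : x < 1 / 2) :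
    ContinuousAt (fun p : ℝ × ℝ => lsvMap p.1 p.2) (w, x) := by
  have e : (fun p : ℝ × ℝ => p.2 + p.2 * (2 * p.2) ^ p.1) =ᶠ[𝓝 (w, x)]
      fun p : ℝ × ℝ => lsvMap p.1 p.2 := by
    have : ∀ᶠ p : ℝ × ℝ in 𝓝 (w, x), p.2 ∈ Set.Ioo 0 (1 / 2) :=
      continuousAt_snd.eventually (isOpen_Ioo.mem_nhds ⟨h0, h⟩)
    filter_upwards [this] with p hp
    exact (lsvMap_of_lt hp.1.le hp.2).symm
  refine ContinuousAt.congr ?_ e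
  refine continuousAt_snd.add (continuousAt_snd.mul ?_)
  exact (continuousAt_const.mul continuousAt_snd).rpow continuousAt_fst
    (Or.inl (by simp; linarith))

/-- By joint continuity, a single interval of parameters to the right of `w` sends every point near
`x` into `O`; compactness makes the lower bound uniform. -/
theorem exists_pos_le_measure_lsvMap (hα : 0 < α) (hε : 0 < ε) {K O : Set ℝ} (hK : IsCompact K)
    (hK' : K ⊆ Set.Ioo 0 (1 / 2)) (hO : IsOpen O) (hKO : ∀ x ∈ K, ∃ w, α < w ∧ lsvMap w x ∈ O) :
    ∃ p : ℝ≥0∞, 0 < p ∧ ∀ x ∈ K, p ≤ paretoMeasure α ε {a | lsvMap a x ∈ O} := by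
  refine hK.induction_on (p := fun S => ∃ p : ℝ≥0∞, 0 < p ∧ ∀ x ∈ S,
    p ≤ paretoMeasure α ε {a | lsvMap a x ∈ O}) ⟨1, one_pos, by simp⟩ ?_ ?_ ?_
  · rintro s t hst ⟨p, hp, h⟩
    exact ⟨p, hp, fun x hx => h x (hst hx)⟩
  · rintro s t ⟨p, hp, h⟩ ⟨q, hq, h'⟩
    refine ⟨min p q, lt_min hp hq, ?_⟩
    rintro x (hx | hx)
    · exact (min_le_left _ _).trans (h x hx)
    · exact (min_le_right _ _).trans (h' x hx)
  · intro x hx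
    obtain ⟨w, hw, hwO⟩ := hKO x hx
    have hc := (continuousAt_lsvMap (w := w) (hK' hx).1 (hK' hx).2).preimage_mem_nhds
      (hO.mem_nhds hwO)
    obtain ⟨u, hu, v, hv, huv⟩ := mem_nhds_prod_iff.1 hc
    have hu2 := inter_mem hu (Ioi_mem_nhds hw)
    obtain ⟨l, r, hlr, hlru⟩ := mem_nhds_iff_exists_Ioo_subset.1 hu2
    refine ⟨v, mem_nhdsWithin_of_mem_nhds hv, paretoMeasure α ε (Set.Ioo w r),
      paretoMeasure_Ioo_pos hα hε hw.le hlr.2, fun z hz => measure_mono fun a ha => ?_⟩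
    exact huv (Set.mk_mem_prod (hlru ⟨hlr.1.trans ha.1, ha.2⟩).1 hz)

/-! ### Petite sets -/

theorem transProb_succ (hα : 0 < α) (hε : 0 < ε) (n : ℕ) (x : ℝ) {A : Set ℝ}
    (hA : MeasurableSet A) :
    transProb α ε (n + 1) x A = ∫⁻ a, transProb α ε n (lsvMap a x) A ∂(paretoMeasure α ε) := by
  have hm : ∀ n x, MeasurableSet {w : ℕ → ℝ | chain w n x ∈ A} := fun n x =>
    ((measurable_chain n).comp (measurable_id.prodMk measurable_const)) hA
  have e : ∀ n x, transProb α ε n x A =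
      ∫⁻ w, {w : ℕ → ℝ | chain w n x ∈ A}.indicator 1 w ∂(paramLaw α ε) := fun n x =>
    (lintegral_indicator_one (hm n x)).symm
  rw [e, lintegral_paramLaw hα hε (measurable_one.indicator (hm _ _))]
  refine lintegral_congr fun a => ?_
  rw [e]
  refine lintegral_congr fun w => ?_
  have : chain (consSeq a w) (n + 1) x = chain w n (lsvMap a x) := chain_succ' _ _ _
  by_cases h : chain w n (lsvMap a x) ∈ A
  · rw [Set.indicator_of_mem, Set.indicator_of_mem]
    · rfl
    · exact h
    · show _ ∈ A
      rw [this]; exact h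
  · rw [Set.indicator_of_notMem, Set.indicator_of_notMem]
    · exact h
    · show ¬ _ ∈ A
      rw [this]; exact h

theorem transProb_one (hα : 0 < α) (hε : 0 < ε) (x : ℝ) {A : Set ℝ} (hA : MeasurableSet A) :
    transProb α ε 1 x A = paretoMeasure α ε {a | lsvMap a x ∈ A} := by
  have : IsProbabilityMeasure (paretoMeasure α ε) := isProbabilityMeasure_paretoMeasure hα hε
  have : IsProbabilityMeasure (paramLaw α ε) := by unfold paramLaw; infer_instance
  have h0 : MeasurableSet {a | lsvMap a x ∈ A} := measurable_lsvMap_left x hA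
  rw [transProb_succ hα hε 0 x hA, ← lintegral_indicator_one h0]
  refine lintegral_congr fun a => ?_
  unfold transProb chain
  by_cases h : lsvMap a x ∈ A
  · rw [Set.indicator_of_mem (show a ∈ {a | lsvMap a x ∈ A} from h)]
    simp [h]
  · rw [Set.indicator_of_notMem (show a ∉ {a | lsvMap a x ∈ A} from h)]
    simp [h]

theorem paretoPDFReal_anti (hα : 0 < α) (hε : 0 < ε) {u v : ℝ} (hu : α ≤ u) (huv : u ≤ v) :
    paretoPDFReal α ε v ≤ paretoPDFReal α ε u := by
  rw [paretoPDFReal, paretoPDFReal, if_pos hu, if_pos (hu.trans huv)]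
  have := Real.rpow_le_rpow_of_nonpos (hα.trans_le hu) huv (by linarith : -(ε + 1) ≤ 0)
  have h2 : 0 < α ^ ε := Real.rpow_pos_of_pos hα ε
  gcongr

/-- Uniform density lower bound on `[1/2, 3/4]` for starting points away from `0` and `1/2`. -/
theorem exists_volume_le_lsvMap (hα : 0 < α) (hε : 0 < ε) {u v : ℝ} (hu : 0 < u) (hv : v < 1 / 2)
    (hfu : 3 / 4 ≤ lsvMap α u) :
    ∃ κ : ℝ, 0 < κ ∧ ∀ y ∈ Set.Ioo u v, ∀ A, MeasurableSet A →
      volume (A ∩ Set.Icc (1 / 2) (3 / 4)) ≤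
        ENNReal.ofReal κ * paretoMeasure α ε {a | lsvMap a y ∈ A} := by
  rcases le_or_gt v u with hvu | huv
  · exact ⟨1, one_pos, fun y hy => absurd (hy.1.trans hy.2) (not_lt.2 hvu)⟩
  have hT : 0 < -Real.log (2 * u) := neg_log_two_mul_pos hu (huv.trans hv)
  have ht0 : 0 < -Real.log (2 * v) := neg_log_two_mul_pos (hu.trans huv) hv
  -- If `y < v` and `f_w(y) ≥ 1/2`, then `(2y)^w ≥ 2 (1/2 - v)`, which forces `w ≤ W`. On `[α, W]`
  -- the decreasing Pareto density is at least its value at `W`.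
  set W := max α (-Real.log (2 * (1 / 2 - v)) / -Real.log (2 * v)) with hW
  have hh : 0 < paretoPDFReal α ε W := paretoPDFReal_pos hα hε (le_max_left _ _)
  refine ⟨-Real.log (2 * u) / paretoPDFReal α ε W, div_pos hT hh, fun y hy A hA => ?_⟩
  have hy0 : 0 < y := hu.trans hy.1
  have hy1 : y < 1 / 2 := hy.2.trans hv
  refine (volume_le_lsvMap (α := α) (ε := ε) hy0 hy1 (div_pos hT hh).le
    (hA.inter measurableSet_Icc) ?_ ?_).trans ?_
  · rintro z ⟨-, hz⟩
    exact ⟨hy1.trans_le hz.1, hz.2.trans (hfu.trans (lsvMap_lt_lsvMap hα hu.le hy.1 hy1).le)⟩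
  · rintro w hw ⟨-, hz⟩
    have hwW : w ≤ W := by
      refine le_trans ?_ (le_max_right _ _)
      rw [le_div_iff₀ ht0]
      have h1 : 2 * (1 / 2 - v) ≤ (2 * y) ^ w := by
        have h2 := hz.1
        rw [lsvMap_of_lt hy0.le hy1] at h2
        have h3 : 0 < (2 * y) ^ w := Real.rpow_pos_of_pos (by linarith) w
        nlinarith [hy.2]
      have h4 := Real.log_le_log (by linarith) h1
      rw [Real.log_rpow (by linarith)] at h4
      have h5 : Real.log (2 * y) ≤ Real.log (2 * v) :=
        Real.log_le_log (by linarith) (by linarith [hy.2])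
      nlinarith [hα.trans_le hw]
    have h6 := paretoPDFReal_anti hα hε hw hwW
    have h7 : -Real.log (2 * y) ≤ -Real.log (2 * u) :=
      neg_le_neg (Real.log_le_log (by linarith) (by linarith [hy.1]))
    have h8 : 0 ≤ -Real.log (2 * y) := (neg_log_two_mul_pos hy0 hy1).le
    calc (lsvMap w y - y) * -Real.log (2 * y) ≤ 1 * -Real.log (2 * u) :=
          mul_le_mul (by linarith [hz.2]) h7 h8 one_pos.le
      _ = -Real.log (2 * u) / paretoPDFReal α ε W * paretoPDFReal α ε W := by
          field_simp
      _ ≤ _ := mul_le_mul_of_nonneg_left h6 (div_pos hT hh).le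
  · gcongr
    exact fun _ h => h.1

/-- The distribution `a` is the point mass at `2`. The first step enters an interval `(u, v)` around
`b`, chosen with `f_α(u) > 3/4` and `v < 1/2`; from there the second step dominates a multiple of
Lebesgue measure on `[1/2, 3/4]`. -/
theorem isPetite_Icc {b c : ℝ} (hα : 0 < α) (hε : 0 < ε) (hb0 : 0 < b) (hb : b < 1 / 2)
    (hfb : 3 / 4 < lsvMap α b) (hc0 : 0 < c) (hc1 : c < 1 / 2)
    (hcb : lsvMap α c = b) :
    IsPetite α ε (Set.Icc c b) := by
  have hcb' : c < b := hcb ▸ lt_lsvMap hc0 hc1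
  have hcont : ContinuousAt (fun x => lsvMap α x) b :=
    (continuousAt_lsvMap (w := α) hb0 hb).comp (f := fun x => (α, x))
      (continuousAt_const.prodMk continuousAt_id)
  obtain ⟨u, hu1, hcu, hub⟩ : ∃ u, 3 / 4 < lsvMap α u ∧ c < u ∧ u < b := by
    have h1 : ∀ᶠ x in 𝓝[<] b, 3 / 4 < lsvMap α x :=
      (hcont.eventually (lt_mem_nhds hfb)).filter_mono nhdsWithin_le_nhds
    have h2 : ∀ᶠ x in 𝓝[<] b, c < x :=
      (lt_mem_nhds hcb').filter_mono nhdsWithin_le_nhds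
    have h3 : ∀ᶠ x in 𝓝[<] b, x < b := eventually_mem_nhdsWithin
    exact (h1.and (h2.and h3)).exists
  set v := (b + 1 / 2) / 2 with hv
  obtain ⟨p, hp0, hp⟩ := exists_pos_le_measure_lsvMap hα hε (isCompact_Icc (a := c) (b := b))
    (fun x hx => ⟨hc0.trans_le hx.1, hx.2.trans_lt hb⟩) (isOpen_Ioo (a := u) (b := v))
    (fun x hx => by
      have hx0 : 0 < x := hc0.trans_le hx.1
      have hx1 : x < 1 / 2 := hx.2.trans_lt hb
      have h1 : b ≤ lsvMap α x := by
        rcases hx.1.eq_or_lt with h | h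
        · rw [← h, hcb]
        · rw [← hcb]; exact (lsvMap_lt_lsvMap hα hc0.le h hx1).le
      have h2 : max x u < min v (lsvMap α x) := by
        refine max_lt (lt_min (by linarith [hx.2]) (lt_lsvMap hx0 hx1))
          (lt_min (by linarith) (by linarith))
      obtain ⟨z, hz1, hz2⟩ := exists_between h2
      obtain ⟨w, hw, rfl⟩ := (exists_lsvMap_eq hx0 hx1 ((le_max_left _ _).trans_lt hz1)).2
        (hz2.trans_le (min_le_right _ _))
      exact ⟨w, hw, (le_max_right _ _).trans_lt hz1, hz2.trans_le (min_le_left _ _)⟩)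
  obtain ⟨κ, hκ, hvol⟩ := exists_volume_le_lsvMap hα hε (hc0.trans hcu) (by linarith : v < 1 / 2)
    hu1.le
  have hκ0 : ENNReal.ofReal κ ≠ 0 := by simpa using hκ
  refine ⟨measurableSet_Icc, fun n => if n = 2 then 1 else 0,
    (p * (ENNReal.ofReal κ)⁻¹) • volume.restrict (Set.Icc (1 / 2) (3 / 4)), by simp,
    by simp, ?_, fun x hx A hA => ?_⟩
  · intro h
    have h1 := congrArg (fun m : Measure ℝ => m Set.univ) h
    simp only [Measure.smul_apply, Measure.restrict_apply_univ, Real.volume_Icc, smul_eq_mul,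
      Measure.coe_zero, Pi.zero_apply, mul_eq_zero, ENNReal.inv_eq_zero, ENNReal.ofReal_ne_top,
      or_false, hp0.ne', false_or, ENNReal.ofReal_eq_zero] at h1
    norm_num at h1
  · have e : ∑' n, (if n = 2 then (1 : ℝ≥0∞) else 0) * transProb α ε n x A =
        transProb α ε 2 x A := by
      rw [tsum_eq_single 2 (by intro n hn; simp [hn])]
      simp
    rw [e, transProb_succ hα hε 1 x hA, Measure.smul_apply, smul_eq_mul, Measure.restrict_apply hA]
    have hms : MeasurableSet {a | lsvMap a x ∈ Set.Ioo u v} :=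
      measurable_lsvMap_left x measurableSet_Ioo
    calc p * (ENNReal.ofReal κ)⁻¹ * volume (A ∩ Set.Icc (1 / 2) (3 / 4))
        ≤ paretoMeasure α ε {a | lsvMap a x ∈ Set.Ioo u v} * (ENNReal.ofReal κ)⁻¹ *
          volume (A ∩ Set.Icc (1 / 2) (3 / 4)) := by gcongr; exact hp x hx
      _ = ∫⁻ a in {a | lsvMap a x ∈ Set.Ioo u v}, (ENNReal.ofReal κ)⁻¹ *
          volume (A ∩ Set.Icc (1 / 2) (3 / 4)) ∂(paretoMeasure α ε) := by
          rw [setLIntegral_const]; ring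
      _ ≤ ∫⁻ a in {a | lsvMap a x ∈ Set.Ioo u v}, transProb α ε 1 (lsvMap a x) A
          ∂(paretoMeasure α ε) := by
          refine setLIntegral_mono' hms fun a ha => ?_
          rw [transProb_one hα hε _ hA, mul_comm, ← div_eq_mul_inv]
          exact ENNReal.div_le_of_le_mul' (hvol _ ha A hA)
      _ ≤ _ := setLIntegral_le_lintegral _ _

/-! ### Rate functions -/

theorem isSubgeometricRate_rpow {s : ℝ} (hs : 0 < s) :
    IsSubgeometricRate fun n : ℕ => (n : ℝ) ^ s := by
  have hlim : Tendsto (fun n : ℕ => ((n : ℝ) ^ s / (2 * ((n : ℝ) + 1) ^ s) : ℝ)) atTop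
      (𝓝 (1 / 2)) := by
    have h1 : Tendsto (fun n : ℕ => ((n : ℝ) / ((n : ℝ) + 1)) ^ s / 2) atTop
        (𝓝 ((1 : ℝ) ^ s / 2)) :=
      ((tendsto_natCast_div_add_atTop (1 : ℝ)).rpow_const (Or.inr hs.le)).div_const 2
    rw [Real.one_rpow] at h1
    refine h1.congr fun n => ?_
    rw [Real.div_rpow (by positivity) (by positivity)]
    field_simp
  have hE : Tendsto (fun n : ℕ => (((n : ℝ) ^ s / (2 * ((n : ℝ) + 1) ^ s) : ℝ) : EReal)) atTop
      (𝓝 ((1 / 2 : ℝ) : EReal)) := (continuous_coe_real_ereal.tendsto _).comp hlim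
  -- The factor `2` secures `2 ≤ r₀ 1`; the ratio to `r₀` tends to `1/2`.
  refine ⟨fun n => 2 * ((n : ℝ) + 1) ^ s, ?_, ?_, ?_, ?_, ?_⟩
  · intro m n hmn
    have : (m : ℝ) ≤ n := by exact_mod_cast hmn
    dsimp only
    gcongr
  · have : (1 : ℝ) ≤ ((1 : ℕ) + 1 : ℝ) ^ s :=
      Real.one_le_rpow (by norm_num) hs.le
    linarith
  · have h1 : Tendsto (fun n : ℕ => Real.log ((n : ℝ) + 1) / ((n : ℝ) + 1)) atTop (𝓝 0) := by
      have := (Real.isLittleO_log_id_atTop.tendsto_div_nhds_zero).comp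
        (tendsto_atTop_add_const_right atTop (1 : ℝ) tendsto_natCast_atTop_atTop)
      exact this
    have h2 : Tendsto (fun n : ℕ => ((n : ℝ) / ((n : ℝ) + 1))⁻¹) atTop (𝓝 (1 : ℝ)⁻¹) :=
      (tendsto_natCast_div_add_atTop (1 : ℝ)).inv₀ one_ne_zero
    have h3 : Tendsto (fun n : ℕ => Real.log 2 / (n : ℝ)) atTop (𝓝 0) :=
      tendsto_const_div_atTop_nhds_zero_nat _
    have h4 := h3.add (((h1.const_mul s).mul h2))
    simp only [mul_zero, zero_mul, add_zero] at h4
    refine h4.congr' ?_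
    filter_upwards [eventually_gt_atTop 0] with n hn
    have hn' : (0 : ℝ) < n := by exact_mod_cast hn
    rw [Real.log_mul (by norm_num) (by positivity), Real.log_rpow (by positivity)]
    field_simp
  · rw [hE.liminf_eq]
    exact_mod_cast (by norm_num : (0 : ℝ) < 1 / 2)
  · rw [hE.limsup_eq]
    exact EReal.coe_lt_top _

/-- Each of the `T` summands is at most `T^(γ-1)`. -/
theorem sumUpTo_rpow_le {γ : ℝ} (hγ : 1 < γ) (T : ℕ∞) :
    sumUpTo (fun n : ℕ => (n : ℝ) ^ (γ - 1)) T ≤ (T : ℝ≥0∞) ^ γ := by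
  induction T using ENat.recTopCoe with
  | top => simp [show 0 < γ by linarith]
  | coe N =>
    unfold sumUpTo
    rw [tsum_eq_sum (s := Finset.range N) (fun n hn => by
      rw [if_neg]; simpa using hn)]
    calc _ ≤ ∑ n ∈ Finset.range N, (N : ℝ≥0∞) ^ (γ - 1) := by
          refine Finset.sum_le_sum fun n hn => ?_
          have hn' := Finset.mem_range.1 hn
          rw [if_pos (by exact_mod_cast hn'),
            ← ENNReal.ofReal_rpow_of_nonneg (Nat.cast_nonneg _) (by linarith),
            ENNReal.ofReal_natCast]
          refine ENNReal.rpow_le_rpow (by exact_mod_cast hn'.le) (by linarith)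
      _ = (N : ℝ≥0∞) ^ γ := by
          rw [Finset.sum_const, Finset.card_range, nsmul_eq_mul]
          rcases Nat.eq_zero_or_pos N with rfl | hN
          · simp [show 0 < γ by linarith]
          · have h0 : (N : ℝ≥0∞) ≠ 0 := by exact_mod_cast hN.ne'
            nth_rewrite 1 [← ENNReal.rpow_one (N : ℝ≥0∞)]
            rw [← ENNReal.rpow_add _ _ h0 (ENNReal.natCast_ne_top N)]
            congr 1
            ring
      _ ≤ _ := by simp

/-! ### Passages through the right branch -/

/-- The number of steps along the right branch before a point of `[0, 1)` enters `[0, 1/2)`. -/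
noncomputable def dblCount (y : ℝ) : ℕ := Nat.log 2 ⌊(1 - y)⁻¹⌋₊

/-- The point at which the orbit of a point of `[0, 1)` along the right branch enters
`[0, 1/2)`. -/
noncomputable def leftEntry (y : ℝ) : ℝ := 1 - 2 ^ dblCount y * (1 - y)

/-- The points that enter `[0, 1/2)` after exactly `k` steps along the right branch. -/
def dblCell (k : ℕ) : Set ℝ := {y | 1 - 2 ^ k * (1 - y) ∈ Set.Ico (0 : ℝ) (1 / 2)}

theorem measurable_dblCount : Measurable dblCount :=
  measurable_from_top.comp (Nat.measurable_floor.comp (measurable_const.sub measurable_id).inv)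

theorem measurable_leftEntry : Measurable leftEntry := by
  have h : Measurable fun y => (2 : ℝ) ^ dblCount y :=
    (measurable_from_top (f := fun n : ℕ => (2 : ℝ) ^ n)).comp measurable_dblCount
  exact measurable_const.sub (h.mul (measurable_const.sub measurable_id))

theorem measurableSet_dblCell (k : ℕ) : MeasurableSet (dblCell k) := by
  have : Measurable fun y : ℝ => 1 - 2 ^ k * (1 - y) := by fun_prop
  exact this measurableSet_Ico

theorem dblCount_eq_iff {y : ℝ} (h0 : 0 ≤ y) (h1 : y < 1) (k : ℕ) :
    dblCount y = k ↔ y ∈ dblCell k := by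
  have hy : 0 < 1 - y := by linarith
  have hinv : 1 ≤ (1 - y)⁻¹ := (one_le_inv₀ hy).2 (by linarith)
  have hfl : ⌊(1 - y)⁻¹⌋₊ ≠ 0 := (Nat.floor_pos.2 hinv).ne'
  -- The floor loses nothing, because the thresholds `2^k` and `2^(k+1)` are integers.
  rw [dblCount, Nat.log_eq_iff (Or.inr ⟨by norm_num, hfl⟩), Nat.le_floor_iff (by positivity),
    Nat.floor_lt (by positivity)]
  push_cast
  rw [le_inv_comm₀ (by positivity) hy, inv_lt_comm₀ hy (by positivity), pow_succ]
  simp only [dblCell, Set.mem_Ico]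
  show _ ↔ _ ∧ _
  rw [← one_div, ← one_div, le_div_iff₀ (by positivity), div_lt_iff₀ (by positivity)]
  constructor <;> rintro ⟨h, h'⟩ <;> constructor <;> linarith

theorem mem_dblCell_dblCount {y : ℝ} (h0 : 0 ≤ y) (h1 : y < 1) : y ∈ dblCell (dblCount y) :=
  (dblCount_eq_iff h0 h1 _).1 rfl

theorem dblCount_of_lt {y : ℝ} (h0 : 0 ≤ y) (h1 : y < 1 / 2) : dblCount y = 0 :=
  (dblCount_eq_iff h0 (by linarith) 0).2 ⟨by simpa using h0, by simpa using h1⟩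

theorem leftEntry_of_lt {y : ℝ} (h0 : 0 ≤ y) (h1 : y < 1 / 2) : leftEntry y = y := by
  rw [leftEntry, dblCount_of_lt h0 h1]; simp

theorem dblCount_two_mul_sub_one {y : ℝ} (h0 : 1 / 2 ≤ y) (h1 : y < 1) :
    dblCount y = dblCount (2 * y - 1) + 1 := by
  have h := mem_dblCell_dblCount (y := 2 * y - 1) (by linarith) (by linarith)
  refine (dblCount_eq_iff (by linarith) h1 _).2 ?_
  have e : 1 - (2 : ℝ) ^ (dblCount (2 * y - 1) + 1) * (1 - y) =
    1 - 2 ^ dblCount (2 * y - 1) * (1 - (2 * y - 1)) := by rw [pow_succ]; ring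
  show 1 - (2 : ℝ) ^ (dblCount (2 * y - 1) + 1) * (1 - y) ∈ Set.Ico (0 : ℝ) (1 / 2)
  rw [e]
  exact h

theorem leftEntry_two_mul_sub_one {y : ℝ} (h0 : 1 / 2 ≤ y) (h1 : y < 1) :
    leftEntry (2 * y - 1) = leftEntry y := by
  rw [leftEntry, leftEntry, dblCount_two_mul_sub_one h0 h1, pow_succ]; ring

theorem dblCount_mono {y z : ℝ} (hyz : y ≤ z) (h1 : z < 1) :
    dblCount y ≤ dblCount z := by
  refine Nat.log_mono_right (Nat.floor_mono ?_)
  exact inv_anti₀ (by linarith) (by linarith)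

/-- The count is at most `log₂ (1/s)` with `s = 1/2 - x`, and a logarithm is dominated by any
negative power of `s`. -/
theorem exists_dblCount_le {δ : ℝ} (hδ : 0 < δ) : ∃ Λ : ℝ, 0 < Λ ∧ ∀ x : ℝ, 0 ≤ x → x < 1 / 2 →
    (dblCount (2 * x) : ℝ) + 1 ≤ Λ * (1 / 2 - x) ^ (-δ) := by
  have hl : 0 < Real.log 2 := Real.log_pos (by norm_num)
  have hd : 0 < δ * Real.log 2 := by positivity
  refine ⟨1 + 1 / (δ * Real.log 2), by positivity, fun x h0 h1 => ?_⟩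
  have hs : 0 < 1 / 2 - x := by linarith
  set k := dblCount (2 * x)
  have hk : (2 : ℝ) ^ k * (1 - 2 * x) ≤ 1 := by
    have := (mem_dblCell_dblCount (y := 2 * x) (by linarith) (by linarith)).1
    linarith
  have h2 : (2 : ℝ) ^ (k : ℝ) ≤ (1 / 2 - x)⁻¹ := by
    rw [Real.rpow_natCast, ← one_div, le_div_iff₀ hs]
    have : (0 : ℝ) < 2 ^ k := by positivity
    nlinarith
  have h3 := Real.rpow_le_rpow (by positivity) h2 hδ.le
  rw [Real.inv_rpow hs.le, ← Real.rpow_neg hs.le, ← Real.rpow_mul (by norm_num)] at h3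
  have h4 : 1 + (k : ℝ) * (δ * Real.log 2) ≤ (2 : ℝ) ^ ((k : ℝ) * δ) := by
    rw [Real.rpow_def_of_pos (by norm_num)]
    have := Real.add_one_le_exp (Real.log 2 * ((k : ℝ) * δ))
    linarith
  calc (k : ℝ) + 1 ≤ (1 + 1 / (δ * Real.log 2)) * (1 + (k : ℝ) * (δ * Real.log 2)) := by
        have : (1 + 1 / (δ * Real.log 2)) * (1 + (k : ℝ) * (δ * Real.log 2)) =
          1 + k + (k : ℝ) * (δ * Real.log 2) + 1 / (δ * Real.log 2) := by field_simp; ring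
        rw [this]
        have h5 : 0 ≤ (k : ℝ) * (δ * Real.log 2) := by positivity
        have h6 : 0 ≤ 1 / (δ * Real.log 2) := by positivity
        linarith
    _ ≤ _ := by gcongr; exact h4.trans h3

/-- The `k`-fold doubling is affine with slope `2^k` from the cell onto `[0, 1/2)`. A density of
order `2^k` on the cell therefore becomes a bounded density at the entry point. -/
theorem lintegral_dblCell (k : ℕ) (F : ℝ → ℝ≥0∞) :
    ∫⁻ y in Set.Ico (0 : ℝ) (1 / 2), F y =
      ENNReal.ofReal (2 ^ k) * ∫⁻ y in dblCell k, F (1 - 2 ^ k * (1 - y)) := by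
  have hd : ∀ y ∈ dblCell k, HasDerivWithinAt (fun y : ℝ => 1 - 2 ^ k * (1 - y)) (2 ^ k)
      (dblCell k) y := by
    intro y _
    have := (((hasDerivAt_id y).const_sub 1).const_mul ((2 : ℝ) ^ k)).const_sub 1
    exact (this.congr_deriv (by ring)).hasDerivWithinAt
  have hinj : Set.InjOn (fun y : ℝ => 1 - 2 ^ k * (1 - y)) (dblCell k) := by
    intro a _ b _ hab
    have h2 : (2 : ℝ) ^ k ≠ 0 := by positivity
    have : (2 : ℝ) ^ k * (1 - a) = 2 ^ k * (1 - b) := by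
      have : 1 - (2 : ℝ) ^ k * (1 - a) = 1 - 2 ^ k * (1 - b) := hab
      linarith
    have := mul_left_cancel₀ h2 this
    linarith
  have himg : (fun y : ℝ => 1 - 2 ^ k * (1 - y)) '' dblCell k = Set.Ico 0 (1 / 2) := by
    ext z
    constructor
    · rintro ⟨y, hy, rfl⟩
      exact hy
    · intro hz
      have e : 1 - (2 : ℝ) ^ k * (1 - (1 - (1 - z) / 2 ^ k)) = z := by field_simp; ring
      refine ⟨1 - (1 - z) / 2 ^ k, ?_, e⟩
      show 1 - (2 : ℝ) ^ k * (1 - (1 - (1 - z) / 2 ^ k)) ∈ Set.Ico (0 : ℝ) (1 / 2)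
      rw [e]
      exact hz
  have := lintegral_image_eq_lintegral_abs_deriv_mul (measurableSet_dblCell k) hd hinj F
  rw [himg] at this
  rw [this, ← lintegral_const_mul' _ _ ENNReal.ofReal_ne_top]
  refine lintegral_congr fun y => ?_
  rw [abs_of_pos (by positivity)]

/-- The singular weight `z^(-β) + (1/2 - z)^(-β)`. -/
noncomputable def endWeight (β z : ℝ) : ℝ≥0∞ :=
  ENNReal.ofReal z ^ (-β) + ENNReal.ofReal (1 / 2 - z) ^ (-β)

theorem measurable_endWeight (β : ℝ) : Measurable (endWeight β) := by
  unfold endWeight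
  fun_prop

theorem lintegral_endWeight_lt_top {β : ℝ} (hβ : β < 1) :
    ∫⁻ z in Set.Ico (0 : ℝ) (1 / 2), endWeight β z < ⊤ := by
  have h1 : ∫⁻ z in Set.Ioo (0 : ℝ) (1 / 2), ENNReal.ofReal z ^ (-β) < ⊤ := by
    have hi := (intervalIntegral.integrableOn_Ioo_rpow_iff (s := -β) (t := 1 / 2)
      (by norm_num)).2 (by linarith)
    refine lt_of_le_of_lt (le_of_eq ?_) hi.lintegral_lt_top
    refine setLIntegral_congr_fun measurableSet_Ioo fun z hz => ?_
    exact ENNReal.ofReal_rpow_of_pos hz.1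
  have h2 : ∫⁻ z in Set.Ioo (0 : ℝ) (1 / 2), ENNReal.ofReal (1 / 2 - z) ^ (-β) =
      ∫⁻ z in Set.Ioo (0 : ℝ) (1 / 2), ENNReal.ofReal z ^ (-β) := by
    have := (Measure.measurePreserving_sub_left volume (1 / 2 : ℝ)).setLIntegral_comp_preimage
      (measurableSet_Ioo (a := (0 : ℝ)) (b := 1 / 2))
      (f := fun z => ENNReal.ofReal z ^ (-β)) (by fun_prop)
    rw [← this]
    congr 2
    ext z
    simp only [Set.mem_preimage, Set.mem_Ioo]
    constructor <;> rintro ⟨h, h'⟩ <;> constructor <;> linarith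
  rw [setLIntegral_congr Ioo_ae_eq_Ico.symm]
  unfold endWeight
  rw [lintegral_add_left (by fun_prop), h2]
  exact ENNReal.add_lt_top.2 ⟨h1, h1⟩

/-! ### Density bounds -/

theorem paretoMeasure_Ici_le (hα : 0 < α) (hε : 0 < ε) {u : ℝ} (hu : 0 < u) :
    paretoMeasure α ε (Set.Ici u) ≤ ENNReal.ofReal ((α / u) ^ ε) := by
  have : IsProbabilityMeasure (paretoMeasure α ε) := isProbabilityMeasure_paretoMeasure hα hε
  rcases le_total u α with h | h
  · refine prob_le_one.trans ?_
    rw [ENNReal.one_le_ofReal]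
    exact Real.one_le_rpow ((one_le_div hu).2 h) hε.le
  · have hi := integrableOn_Ioi_rpow_of_lt (a := -(ε + 1)) (by linarith) hu
    have hval := integral_Ioi_rpow_of_lt (a := -(ε + 1)) (by linarith) hu
    rw [paretoMeasure, withDensity_apply _ measurableSet_Ici,
      setLIntegral_congr Ioi_ae_eq_Ici.symm]
    have e : ∫⁻ w in Set.Ioi u, paretoPDF α ε w =
        ∫⁻ w in Set.Ioi u, ENNReal.ofReal (ε * α ^ ε * w ^ (-(ε + 1))) :=
      setLIntegral_congr_fun measurableSet_Ioi fun w hw => paretoPDF_of_le (h.trans (le_of_lt hw))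
    rw [e, ← ofReal_integral_eq_lintegral_ofReal (hi.const_mul _)]
    · refine ENNReal.ofReal_le_ofReal (le_of_eq ?_)
      rw [integral_const_mul, hval, show -(ε + 1) + 1 = -ε by ring, Real.div_rpow hα.le hu.le,
        Real.rpow_neg hu.le]
      field_simp
    · filter_upwards [ae_restrict_mem measurableSet_Ioi] with w hw
      have : 0 < w := hu.trans hw
      positivity

theorem neg_log_two_mul_le {c x : ℝ} (hc : 0 < c) (hcx : c ≤ x) (h : x < 1 / 2) :
    -Real.log (2 * x) ≤ (1 / 2 - x) / c := by
  have hx : 0 < x := hc.trans_le hcx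
  have h1 := Real.one_sub_inv_le_log_of_pos (by linarith : 0 < 2 * x)
  have h2 : (2 * x)⁻¹ - 1 = (1 / 2 - x) / x := by field_simp
  have h3 : (1 / 2 - x) / x ≤ (1 / 2 - x) / c :=
    div_le_div_of_nonneg_left (by linarith) hc hcx
  linarith

/-- Near `1/2`, landing below `3/4` requires a parameter of order at least `1 / (1/2 - x)`; the
Pareto tail makes this rare. -/
theorem exists_le_mul_of_lsvMap_lt (hα : 0 < α) : ∃ c₀ : ℝ, 0 < c₀ ∧ ∀ x : ℝ, 0 < x → x < 1 / 2 →
    ∀ w, α ≤ w → lsvMap w x < 3 / 4 → c₀ ≤ -Real.log (2 * x) * w := by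
  have h1 : 0 < -Real.log (5 / 7) := neg_pos.2 (Real.log_neg (by norm_num) (by norm_num))
  have h2 : 0 < -Real.log (7 / 8) := neg_pos.2 (Real.log_neg (by norm_num) (by norm_num))
  refine ⟨min (-Real.log (5 / 7)) (-Real.log (7 / 8) * α), lt_min h1 (by positivity),
    fun x h0 h w hw hf => ?_⟩
  -- For `x ≥ 7/16`, `(2x)^w < (3/4 - x)/x ≤ 5/7`. For smaller `x` the logarithm is bounded away
  -- from `0` and `w ≥ α` suffices.
  rcases le_or_gt (7 / 16) x with hx | hx
  · refine (min_le_left _ _).trans ?_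
    rw [lsvMap_of_lt h0.le h] at hf
    have h3 : 0 < (2 * x) ^ w := Real.rpow_pos_of_pos (by linarith) w
    have h4 : (2 * x) ^ w ≤ 5 / 7 := by nlinarith
    have h5 := Real.log_le_log h3 h4
    rw [Real.log_rpow (by linarith)] at h5
    linarith
  · refine (min_le_right _ _).trans ?_
    have h3 : -Real.log (7 / 8) ≤ -Real.log (2 * x) :=
      neg_le_neg (Real.log_le_log (by linarith) (by linarith))
    exact mul_le_mul h3 hw hα.le (by linarith)

/-- Write `s = 1/2 - x` and `t = -log (2x) ≤ s/c`. Then `w ≥ c₀/t` makes the Pareto density `O(s^ε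
t)`, while the Jacobian `(f_w(x) - x) t` is at least `s t / 2`; the quotient is `O(s^(ε-1))`. -/
theorem exists_pdf_le_of_lsvMap_lt (hα : 0 < α) (hε : 0 < ε) {c : ℝ} (hc : 0 < c) :
    ∃ κ : ℝ, 0 < κ ∧ ∀ x : ℝ, c ≤ x → x < 1 / 2 → ∀ w, α ≤ w → lsvMap w x < 3 / 4 →
      (1 / 2 - x) / 2 ≤ lsvMap w x - x →
      paretoPDFReal α ε w ≤
        κ * (1 / 2 - x) ^ (ε - 1) * ((lsvMap w x - x) * -Real.log (2 * x)) := by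
  obtain ⟨c₀, hc₀, H⟩ := exists_le_mul_of_lsvMap_lt hα
  refine ⟨2 * (ε * α ^ ε * (1 / (c * c₀)) ^ ε / c₀), by positivity,
    fun x hcx h w hw hf hs => ?_⟩
  have h0 : 0 < x := hc.trans_le hcx
  have hs0 : 0 < 1 / 2 - x := by linarith
  have ht := neg_log_two_mul_pos h0 h
  have htw := H x h0 h w hw hf
  have htc := neg_log_two_mul_le hc hcx h
  set t := -Real.log (2 * x)
  set s := 1 / 2 - x
  have hw0 : 0 < w := hα.trans_le hw
  have h1 : c₀ / t ≤ w := by rw [div_le_iff₀ ht]; linarith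
  have h2 : w ^ (-(ε + 1)) ≤ (t / c₀) ^ ε * (t / c₀) := by
    have := Real.rpow_le_rpow_of_nonpos (div_pos hc₀ ht) h1 (by linarith : -(ε + 1) ≤ 0)
    rwa [Real.rpow_neg (div_pos hc₀ ht).le, ← Real.inv_rpow (div_pos hc₀ ht).le, inv_div,
      Real.rpow_add (by positivity), Real.rpow_one] at this
  have h3 : (t / c₀) ^ ε ≤ (1 / (c * c₀)) ^ ε * s ^ ε := by
    rw [← Real.mul_rpow (by positivity) hs0.le]
    refine Real.rpow_le_rpow (by positivity) ?_ hε.le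
    calc t / c₀ ≤ s / c / c₀ := by gcongr
      _ = 1 / (c * c₀) * s := by field_simp
  have h4 : s ^ ε = s ^ (ε - 1) * s := by
    rw [← Real.rpow_add_one hs0.ne']; ring_nf
  rw [paretoPDFReal, if_pos hw]
  calc ε * α ^ ε * w ^ (-(ε + 1)) ≤ ε * α ^ ε * ((1 / (c * c₀)) ^ ε * s ^ ε * (t / c₀)) := by
        gcongr
        exact h2.trans (by gcongr)
    _ = 2 * (ε * α ^ ε * (1 / (c * c₀)) ^ ε / c₀) * s ^ (ε - 1) * (s / 2 * t) := by
        rw [h4]; field_simp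
    _ ≤ _ := by gcongr

theorem exists_pdf_le_of_le_lsvMap (hα : 0 < α) (hε : 0 < ε) :
    ∃ κ : ℝ, 0 < κ ∧ ∀ x : ℝ, 0 < x → x < 1 / 2 → ∀ w, α ≤ w → 3 / 4 ≤ lsvMap w x →
      paretoPDFReal α ε w ≤
        κ / (1 - lsvMap w x) * ((lsvMap w x - x) * -Real.log (2 * x)) := by
  refine ⟨4 * (1 / α + 1 / 2) * ε, by positivity, fun x h0 h w hw hf => ?_⟩
  have hw0 : 0 < w := hα.trans_le hw
  have ht := neg_log_two_mul_pos h0 h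
  have hy1 : lsvMap w x < 1 := by linarith [lsvMap_lt_two_mul hw0 h0 h]
  -- With `t = -log (2x)`, `1 - f_w(x) = (1 - e^(-t))/2 + (1 - e^(-t(1+w)))/2 ≤ t + t w / 2`, and `t
  -- ≤ t w / α`.
  have hd : 1 - lsvMap w x ≤ -Real.log (2 * x) * w * (1 / α + 1 / 2) := by
    rw [lsvMap_of_lt h0.le h]
    have e1 : 2 * x = Real.exp (Real.log (2 * x)) := (Real.exp_log (by linarith)).symm
    have e2 : 2 * x * (2 * x) ^ w = Real.exp (Real.log (2 * x) * (1 + w)) := by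
      rw [Real.rpow_def_of_pos (by linarith), mul_add, mul_one, Real.exp_add,
        Real.exp_log (by linarith)]
    have h1 := Real.add_one_le_exp (Real.log (2 * x))
    have h2 := Real.add_one_le_exp (Real.log (2 * x) * (1 + w))
    rw [← e1] at h1
    rw [← e2] at h2
    have h3 : -Real.log (2 * x) ≤ -Real.log (2 * x) * w * (1 / α) := by
      rw [mul_assoc]
      refine le_mul_of_one_le_right ht.le ?_
      rw [mul_one_div, one_le_div hα]
      exact hw
    nlinarith
  have hpdf : paretoPDFReal α ε w ≤ ε / w := by
    rw [paretoPDFReal, if_pos hw]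
    have e : ε * α ^ ε * w ^ (-(ε + 1)) = ε / w * (α / w) ^ ε := by
      rw [Real.rpow_neg hw0.le, Real.rpow_add_one hw0.ne', Real.div_rpow hα.le hw0.le]
      field_simp
    rw [e]
    refine mul_le_of_le_one_right (by positivity) ?_
    exact Real.rpow_le_one (by positivity) ((div_le_one hw0).2 hw) hε.le
  refine hpdf.trans ?_
  have hpos : 0 < 1 - lsvMap w x := by linarith
  rw [div_mul_eq_mul_div, div_le_div_iff₀ hw0 hpos]
  calc ε * (1 - lsvMap w x) ≤ ε * (-Real.log (2 * x) * w * (1 / α + 1 / 2)) := by gcongr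
    _ = 4 * (1 / α + 1 / 2) * ε * (1 / 4 * -Real.log (2 * x)) * w := by ring
    _ ≤ _ := by gcongr; linarith

theorem lintegral_indicator_dblCell_le {x κ : ℝ} (h0 : 0 < x) (h : x < 1 / 2) (hκ : 0 ≤ κ) (k : ℕ)
    {F : ℝ → ℝ≥0∞} (hF : Measurable F)
    (hd : ∀ w, α ≤ w → lsvMap w x ∈ dblCell k →
      paretoPDFReal α ε w ≤ κ * 2 ^ k * ((lsvMap w x - x) * -Real.log (2 * x))) :
    ∫⁻ a, (dblCell k).indicator (fun y => F (1 - 2 ^ k * (1 - y))) (lsvMap a x)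
      ∂(paretoMeasure α ε) ≤ ENNReal.ofReal κ * ∫⁻ z in Set.Ico (0 : ℝ) (1 / 2), F z := by
  refine (lintegral_lsvMap_le h0 h (by positivity) (measurableSet_dblCell k)
    (hF.comp (by fun_prop : Measurable fun y : ℝ => 1 - 2 ^ k * (1 - y))) hd).trans ?_
  rw [lintegral_dblCell k F, ENNReal.ofReal_mul hκ, mul_assoc]
  rfl

theorem endWeight_le_of_mem {β c x y : ℝ} (hβ : 0 < β) (hc : 0 < c) (hcx : c ≤ x)
    (hxy : x < y) (hy : y < x + (1 / 2 - x) / 2) :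
    endWeight β y ≤ ENNReal.ofReal ((c ^ (-β) + 2 ^ β) * (1 / 2 - x) ^ (-β)) := by
  have hs : 0 < 1 / 2 - x := by linarith
  have hy0 : 0 < y := by linarith
  have hy1 : 0 < 1 / 2 - y := by linarith
  rw [endWeight, ENNReal.ofReal_rpow_of_pos hy0, ENNReal.ofReal_rpow_of_pos hy1,
    ← ENNReal.ofReal_add (by positivity) (by positivity)]
  refine ENNReal.ofReal_le_ofReal ?_
  have h1 : y ^ (-β) ≤ c ^ (-β) :=
    Real.rpow_le_rpow_of_nonpos hc (by linarith) (by linarith)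
  have h2 : (1 / 2 - y) ^ (-β) ≤ ((1 / 2 - x) / 2) ^ (-β) :=
    Real.rpow_le_rpow_of_nonpos (by linarith) (by linarith) (by linarith)
  have h3 : ((1 / 2 - x) / 2) ^ (-β) = 2 ^ β * (1 / 2 - x) ^ (-β) := by
    rw [Real.div_rpow hs.le (by norm_num), Real.rpow_neg (by norm_num : (0 : ℝ) ≤ 2)]
    field_simp
  have h4 : 1 ≤ (1 / 2 - x) ^ (-β) :=
    Real.one_le_rpow_of_pos_of_le_one_of_nonpos hs (by linarith) (by linarith)
  have h5 : 0 < c ^ (-β) := Real.rpow_pos_of_pos hc _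
  nlinarith

/-- The Jacobian degenerates as `f_w(x)` approaches `x`, so the landing zone is cut at `x + s/2`,
where `s = 1/2 - x`. Above the cut the density bound `O(s^(ε-1))` applies. Below it the weight is
`O(s^(-β))` on an event of probability `O(s^ε)`, and `β < 1` gives `s^(ε-β) ≤ s^(ε-1)`. -/
theorem exists_lintegral_dblCell_zero_le (hα : 0 < α) (hε : 0 < ε) {c β q : ℝ} (hc : 0 < c)
    (hβ0 : 0 < β) (hβ : β < 1) (hq : 1 - ε ≤ q) :
    ∃ M : ℝ, 0 < M ∧ ∀ x, c ≤ x → x < 1 / 2 →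
      ∫⁻ a, (dblCell 0).indicator (endWeight β) (lsvMap a x) ∂(paretoMeasure α ε) ≤
        ENNReal.ofReal (M * (1 / 2 - x) ^ (-q)) := by
  obtain ⟨κ, hκ, hpdf⟩ := exists_pdf_le_of_lsvMap_lt hα hε hc
  obtain ⟨c₀, hc₀, H⟩ := exists_le_mul_of_lsvMap_lt hα
  have hBt := lintegral_endWeight_lt_top hβ
  set B := ∫⁻ z in Set.Ico (0 : ℝ) (1 / 2), endWeight β z with hB
  have hcβ : 0 < c ^ (-β) := Real.rpow_pos_of_pos hc _
  refine ⟨κ * B.toReal + (c ^ (-β) + 2 ^ β) * (α / (c * c₀)) ^ ε, by positivity,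
    fun x hcx h => ?_⟩
  have h0 : 0 < x := hc.trans_le hcx
  have hs0 : 0 < 1 / 2 - x := by linarith
  have ht := neg_log_two_mul_pos h0 h
  have htc := neg_log_two_mul_le hc hcx h
  set t := -Real.log (2 * x) with ht_def
  set s := 1 / 2 - x with hs_def
  have hq1 : s ^ (ε - 1) ≤ s ^ (-q) :=
    Real.rpow_le_rpow_of_exponent_ge hs0 (by linarith) (by linarith)
  have hq2 : s ^ (-β) * s ^ ε ≤ s ^ (-q) := by
    rw [← Real.rpow_add hs0]
    exact Real.rpow_le_rpow_of_exponent_ge hs0 (by linarith) (by linarith)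
  set D := ENNReal.ofReal ((c ^ (-β) + 2 ^ β) * s ^ (-β)) with hD
  have hI : MeasurableSet (Set.Ico (x + s / 2) (1 / 2)) := measurableSet_Ico
  have hbound : ∀ᵐ a ∂(paretoMeasure α ε),
      (dblCell 0).indicator (endWeight β) (lsvMap a x) ≤
        (Set.Ico (x + s / 2) (1 / 2)).indicator (endWeight β) (lsvMap a x) +
          (Set.Ici (c₀ / t)).indicator (fun _ => D) a := by
    filter_upwards [ae_le_paretoMeasure α ε] with a ha
    by_cases h1 : lsvMap a x ∈ dblCell 0
    · have h2 : lsvMap a x < 1 / 2 := by simpa using h1.2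
      rw [Set.indicator_of_mem h1]
      rcases le_or_gt (x + s / 2) (lsvMap a x) with h3 | h3
      · rw [Set.indicator_of_mem (Set.mem_Ico.2 ⟨h3, h2⟩)]
        exact le_self_add
      · have h4 : c₀ / t ≤ a := by
          rw [div_le_iff₀ ht, mul_comm]
          exact H x h0 h a ha (by linarith)
        rw [Set.indicator_of_mem (s := Set.Ici (c₀ / t)) h4]
        exact (endWeight_le_of_mem hβ0 hc hcx (lt_lsvMap h0 h) h3).trans le_add_self
    · rw [Set.indicator_of_notMem h1]
      exact zero_le
  have h1 : ∫⁻ a, (Set.Ico (x + s / 2) (1 / 2)).indicator (endWeight β) (lsvMap a x)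
      ∂(paretoMeasure α ε) ≤ ENNReal.ofReal (κ * s ^ (ε - 1)) * B := by
    refine (lintegral_lsvMap_le (κ := κ * s ^ (ε - 1)) h0 h (by positivity) hI
      (measurable_endWeight β) ?_).trans ?_
    · exact fun w hw hy => hpdf x hcx h w hw (by linarith [hy.2]) (by linarith [hy.1])
    · gcongr
      exact lintegral_mono_set (Set.Ico_subset_Ico_left (by linarith))
  have h2 : ∫⁻ a, (Set.Ici (c₀ / t)).indicator (fun _ => D) a ∂(paretoMeasure α ε) ≤
      D * ENNReal.ofReal ((α / (c * c₀)) ^ ε * s ^ ε) := by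
    rw [lintegral_indicator_const measurableSet_Ici]
    gcongr
    refine (paretoMeasure_Ici_le hα hε (div_pos hc₀ ht)).trans (ENNReal.ofReal_le_ofReal ?_)
    rw [← Real.mul_rpow (by positivity) hs0.le]
    refine Real.rpow_le_rpow (by positivity) ?_ hε.le
    calc α / (c₀ / t) = α / c₀ * t := by field_simp
      _ ≤ α / c₀ * (s / c) := by gcongr
      _ = _ := by field_simp
  have hmI : Measurable fun a => (Set.Ico (x + s / 2) (1 / 2)).indicator (endWeight β)
      (lsvMap a x) := ((measurable_endWeight β).indicator hI).comp (measurable_lsvMap_left x)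
  calc _ ≤ ∫⁻ a, ((Set.Ico (x + s / 2) (1 / 2)).indicator (endWeight β) (lsvMap a x) +
          (Set.Ici (c₀ / t)).indicator (fun _ => D) a) ∂(paretoMeasure α ε) :=
        lintegral_mono_ae hbound
    _ ≤ ENNReal.ofReal (κ * s ^ (ε - 1)) * B +
          D * ENNReal.ofReal ((α / (c * c₀)) ^ ε * s ^ ε) := by
        rw [lintegral_add_left hmI]
        exact add_le_add h1 h2
    _ = ENNReal.ofReal (κ * s ^ (ε - 1) * B.toReal +
          (c ^ (-β) + 2 ^ β) * s ^ (-β) * ((α / (c * c₀)) ^ ε * s ^ ε)) := by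
        rw [ENNReal.ofReal_add (by positivity) (by positivity),
          ENNReal.ofReal_mul (p := κ * s ^ (ε - 1)) (by positivity),
          ENNReal.ofReal_toReal hBt.ne, ← ENNReal.ofReal_mul (by positivity)]
    _ ≤ _ := by
        refine ENNReal.ofReal_le_ofReal ?_
        calc _ = κ * B.toReal * s ^ (ε - 1) +
              (c ^ (-β) + 2 ^ β) * (α / (c * c₀)) ^ ε * (s ^ (-β) * s ^ ε) := by ring
          _ ≤ κ * B.toReal * s ^ (-q) +
              (c ^ (-β) + 2 ^ β) * (α / (c * c₀)) ^ ε * s ^ (-q) := by gcongr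
          _ = _ := by ring

/-- The bound is uniform in `k`. Cell `1` is `[1/2, 3/4)`, where the density is `O(s^(ε-1))`, `s =
1/2 - x`. In cells `k ≥ 2` the density is `O(1/(1-y)) = O(2^k)`, exactly compensated by the
expansion `2^k`. -/
theorem exists_lintegral_dblCell_le (hα : 0 < α) (hε : 0 < ε) {c β q : ℝ} (hc : 0 < c)
    (hβ0 : 0 < β) (hβ : β < 1) (hq0 : 0 ≤ q) (hq : 1 - ε ≤ q) :
    ∃ M : ℝ, 0 < M ∧ ∀ x, c ≤ x → x < 1 / 2 → ∀ k : ℕ,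
      ∫⁻ a, (dblCell k).indicator (fun y => endWeight β (1 - 2 ^ k * (1 - y))) (lsvMap a x)
        ∂(paretoMeasure α ε) ≤ ENNReal.ofReal (M * (1 / 2 - x) ^ (-q)) := by
  obtain ⟨κ₁, hκ₁, hpdf₁⟩ := exists_pdf_le_of_lsvMap_lt hα hε hc
  obtain ⟨κ₂, hκ₂, hpdf₂⟩ := exists_pdf_le_of_le_lsvMap hα hε
  obtain ⟨M, hM, hM0⟩ := exists_lintegral_dblCell_zero_le hα hε hc hβ0 hβ hq
  have hBt := lintegral_endWeight_lt_top hβ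
  set B := ∫⁻ z in Set.Ico (0 : ℝ) (1 / 2), endWeight β z with hB
  refine ⟨M + (κ₁ + 2 * κ₂) * B.toReal, by positivity, fun x hcx h k => ?_⟩
  have h0 : 0 < x := hc.trans_le hcx
  have hs0 : 0 < 1 / 2 - x := by linarith
  have ht := neg_log_two_mul_pos h0 h
  have hq1 : (1 / 2 - x) ^ (ε - 1) ≤ (1 / 2 - x) ^ (-q) :=
    Real.rpow_le_rpow_of_exponent_ge hs0 (by linarith) (by linarith)
  have hq2 : 1 ≤ (1 / 2 - x) ^ (-q) :=
    Real.one_le_rpow_of_pos_of_le_one_of_nonpos hs0 (by linarith) (by linarith)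
  have hfin : ∀ κ : ℝ, 0 ≤ κ → κ ≤ (κ₁ + 2 * κ₂) * (1 / 2 - x) ^ (-q) →
      ENNReal.ofReal κ * B ≤
        ENNReal.ofReal ((M + (κ₁ + 2 * κ₂) * B.toReal) * (1 / 2 - x) ^ (-q)) := by
    intro κ hκ hle
    rw [← ENNReal.ofReal_toReal hBt.ne, ← ENNReal.ofReal_mul hκ]
    refine ENNReal.ofReal_le_ofReal ?_
    have h1 := mul_le_mul_of_nonneg_right hle (ENNReal.toReal_nonneg (a := B))
    have h2 : 0 ≤ M * (1 / 2 - x) ^ (-q) := by positivity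
    rw [ENNReal.toReal_ofReal ENNReal.toReal_nonneg]
    nlinarith
  match k with
  | 0 =>
    have e : (fun y => endWeight β (1 - 2 ^ 0 * (1 - y))) = endWeight β := by
      funext y; congr 1; ring
    rw [e]
    refine (hM0 x hcx h).trans (ENNReal.ofReal_le_ofReal ?_)
    gcongr
    have : 0 ≤ (κ₁ + 2 * κ₂) * B.toReal := by positivity
    linarith
  | 1 =>
    refine (lintegral_indicator_dblCell_le (κ := κ₁ * (1 / 2 - x) ^ (ε - 1)) h0 h (by positivity) 1
      (measurable_endWeight β) fun w hw hy => ?_).trans (hfin _ (by positivity) ?_)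
    · have hy1 : 1 - 2 ^ 1 * (1 - lsvMap w x) < 1 / 2 := hy.2
      have hy2 : 0 ≤ 1 - 2 ^ 1 * (1 - lsvMap w x) := hy.1
      refine (hpdf₁ x hcx h w hw (by linarith) (by linarith)).trans ?_
      have h1 : 0 < lsvMap w x - x := sub_pos.2 (lt_lsvMap h0 h)
      refine mul_le_mul_of_nonneg_right ?_ (by positivity)
      have : 0 < κ₁ * (1 / 2 - x) ^ (ε - 1) := by positivity
      linarith
    · calc κ₁ * (1 / 2 - x) ^ (ε - 1) ≤ κ₁ * (1 / 2 - x) ^ (-q) := by gcongr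
        _ ≤ _ := by gcongr; linarith
  | k + 2 =>
    refine (lintegral_indicator_dblCell_le (κ := 2 * κ₂) h0 h (by positivity) (k + 2)
      (measurable_endWeight β) fun w hw hy => ?_).trans (hfin _ (by positivity) ?_)
    · have hy1 : 1 - 2 ^ (k + 2) * (1 - lsvMap w x) < 1 / 2 := hy.2
      have hy2 : 0 ≤ 1 - 2 ^ (k + 2) * (1 - lsvMap w x) := hy.1
      have h2k : (4 : ℝ) ≤ 2 ^ (k + 2) := by
        have : (1 : ℝ) ≤ 2 ^ k := one_le_pow₀ (by norm_num)
        rw [pow_add]; linarith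
      have hy3 : 0 < 1 - lsvMap w x := by
        by_contra! hneg
        nlinarith
      have hy4 : 3 / 4 ≤ lsvMap w x := by nlinarith
      refine (hpdf₂ x h0 h w hw hy4).trans ?_
      have h1 : 0 < lsvMap w x - x := sub_pos.2 (lt_lsvMap h0 h)
      gcongr
      rw [div_le_iff₀ hy3]
      nlinarith
    · nlinarith

/-- Since `f_w(x) < 2x`, only the cells up to `dblCount (2 * x)` are reached. Their logarithmic
number is absorbed by the gap between `β'` and `max (1 - ε) 0`. -/
theorem exists_lintegral_endWeight_le (hα : 0 < α) (hε : 0 < ε) {c β β' : ℝ} (hc : 0 < c)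
    (hβ0 : 0 < β) (hβ : β < 1) (hβ'0 : 0 < β') (hβ' : 1 - ε < β') :
    ∃ M : ℝ, 0 < M ∧ ∀ x, c ≤ x → x < 1 / 2 →
      ∫⁻ a, endWeight β (leftEntry (lsvMap a x)) ∂(paretoMeasure α ε) ≤
        ENNReal.ofReal (M * (1 / 2 - x) ^ (-β')) := by
  have hqβ : max (1 - ε) 0 < β' := max_lt hβ' hβ'0
  obtain ⟨M, hM, H⟩ := exists_lintegral_dblCell_le hα hε hc hβ0 hβ (le_max_right (1 - ε) 0)
    (le_max_left _ _)
  obtain ⟨Λ, hΛ, hcount⟩ := exists_dblCount_le (sub_pos.2 hqβ)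
  refine ⟨Λ * M, by positivity, fun x hcx h => ?_⟩
  have h0 : 0 < x := hc.trans_le hcx
  have hs0 : 0 < 1 / 2 - x := by linarith
  set N := dblCount (2 * x)
  have hbound : ∀ᵐ a ∂(paretoMeasure α ε), endWeight β (leftEntry (lsvMap a x)) ≤
      ∑ k ∈ Finset.range (N + 1),
        (dblCell k).indicator (fun y => endWeight β (1 - 2 ^ k * (1 - y))) (lsvMap a x) := by
    filter_upwards [ae_le_paretoMeasure α ε] with a ha
    have hy0 : 0 ≤ lsvMap a x := h0.le.trans (lt_lsvMap h0 h).le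
    have hy1 := lsvMap_lt_two_mul (hα.trans_le ha) h0 h
    have hk : dblCount (lsvMap a x) ∈ Finset.range (N + 1) :=
      Finset.mem_range.2 (Nat.lt_succ_of_le (dblCount_mono hy1.le (by linarith)))
    refine le_trans (le_of_eq ?_) (Finset.single_le_sum (fun _ _ => zero_le) hk)
    rw [Set.indicator_of_mem (mem_dblCell_dblCount hy0 (by linarith))]
    rfl
  calc _ ≤ ∫⁻ a, ∑ k ∈ Finset.range (N + 1),
        (dblCell k).indicator (fun y => endWeight β (1 - 2 ^ k * (1 - y))) (lsvMap a x)
          ∂(paretoMeasure α ε) := lintegral_mono_ae hbound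
    _ = ∑ k ∈ Finset.range (N + 1), ∫⁻ a,
        (dblCell k).indicator (fun y => endWeight β (1 - 2 ^ k * (1 - y))) (lsvMap a x)
          ∂(paretoMeasure α ε) := by
        refine lintegral_finsetSum _ fun k _ => ?_
        exact (((measurable_endWeight β).comp
          (by fun_prop : Measurable fun y : ℝ => 1 - 2 ^ k * (1 - y))).indicator
            (measurableSet_dblCell k)).comp (measurable_lsvMap_left x)
    _ ≤ ∑ k ∈ Finset.range (N + 1), ENNReal.ofReal (M * (1 / 2 - x) ^ (-max (1 - ε) 0)) :=
        Finset.sum_le_sum fun k _ => H x hcx h k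
    _ = ENNReal.ofReal (((N : ℝ) + 1) * (M * (1 / 2 - x) ^ (-max (1 - ε) 0))) := by
        rw [Finset.sum_const, Finset.card_range, nsmul_eq_mul,
          ENNReal.ofReal_mul (p := (N : ℝ) + 1) (by positivity)]
        congr 1
        rw [ENNReal.ofReal_add (by positivity) (by norm_num), ENNReal.ofReal_natCast]
        simp
    _ ≤ _ := by
        refine ENNReal.ofReal_le_ofReal ?_
        calc ((N : ℝ) + 1) * (M * (1 / 2 - x) ^ (-max (1 - ε) 0))
            ≤ Λ * (1 / 2 - x) ^ (-(β' - max (1 - ε) 0)) *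
              (M * (1 / 2 - x) ^ (-max (1 - ε) 0)) := by
              gcongr
              exact hcount x h0.le h
          _ = Λ * M * ((1 / 2 - x) ^ (-(β' - max (1 - ε) 0)) *
              (1 / 2 - x) ^ (-max (1 - ε) 0)) := by ring
          _ = _ := by
              rw [← Real.rpow_add hs0]; congr 2; ring

/-! ### Uniform probability of re-entering the left branch below `b` -/

theorem leftEntry_of_mem {k : ℕ} {y : ℝ} (h0 : 0 ≤ y) (h1 : y < 1) (hy : y ∈ dblCell k) :
    leftEntry y = 1 - 2 ^ k * (1 - y) := by
  rw [leftEntry, (dblCount_eq_iff h0 h1 k).2 hy]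

/-- With `1/2 - x = u/48`, Bernoulli gives `(2x)^24 = (1 - u/24)^24 ≤ 1/(1 + u) ≤ 1 - u/2`. Thus an
image within `12 (1/2 - x)` of `1` forces a parameter below `24`. -/
theorem lsvMap_lt_one_sub {x w : ℝ} (h : x < 1 / 2) (hx : 1 / 2 - 1 / 48 ≤ x) (hw : 24 ≤ w) :
    lsvMap w x < 1 - 12 * (1 / 2 - x) := by
  have h0 : 0 < x := by linarith
  refine (lsvMap_anti_left h0 h hw).trans_lt ?_
  rw [lsvMap_of_lt h0.le h]
  have e : (2 * x) ^ (24 : ℝ) = (2 * x) ^ (24 : ℕ) := by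
    rw [← Real.rpow_natCast]; norm_num
  rw [e]
  obtain ⟨u, rfl⟩ : ∃ u, x = 1 / 2 - u / 48 := ⟨48 * (1 / 2 - x), by ring⟩
  have hu0 : 0 < u := by linarith
  have hu1 : u ≤ 1 := by linarith
  have h1 : 1 + u ≤ (1 + u / 24) ^ 24 := by
    have := one_add_mul_le_pow (a := u / 24) (by linarith) 24
    push_cast at this
    linarith
  have h2 : (2 * (1 / 2 - u / 48)) ^ 24 * (1 + u / 24) ^ 24 ≤ 1 := by
    rw [← mul_pow]
    refine pow_le_one₀ ?_ ?_
    · exact mul_nonneg (by linarith) (by linarith)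
    · nlinarith
  have hP : 0 ≤ (2 * (1 / 2 - u / 48)) ^ 24 := by positivity
  generalize (2 * (1 / 2 - u / 48)) ^ 24 = P at h2 hP ⊢
  have h3 : P * (1 + u) ≤ 1 := (mul_le_mul_of_nonneg_left h1 hP).trans h2
  have h4 : P ≤ 1 - u / 2 := by
    by_contra! hlt
    nlinarith [mul_le_mul_of_nonneg_right hlt.le (by linarith : 0 ≤ 1 + u)]
  have h5 := mul_le_mul_of_nonneg_left h4 h0.le
  nlinarith

/-- The estimate is scale invariant: with `s = 1/2 - x`, the target interval has length at least `6
s b` and lies at distance between `3 s` and `12 s` from `1`. The parameters reaching it are at most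
`24`, and the Jacobian there is at most `2 s`, so `s` cancels. -/
theorem exists_le_measure_leftEntry_near (hα : 0 < α) (hα1 : α < 1) (hε : 0 < ε) {b : ℝ}
    (hb0 : 0 < b) (hb : b < 1 / 2) :
    ∃ p : ℝ≥0∞, 0 < p ∧ ∀ x, 1 / 2 - 1 / 48 ≤ x → x < 1 / 2 →
      p ≤ paretoMeasure α ε {a | leftEntry (lsvMap a x) ≤ b} := by
  have hh : 0 < paretoPDFReal α ε 24 := paretoPDFReal_pos hα hε (by linarith)
  refine ⟨ENNReal.ofReal (3 * b * paretoPDFReal α ε 24), ENNReal.ofReal_pos.2 (by positivity),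
    fun x hx h => ?_⟩
  have h0 : 0 < x := by linarith
  have hs0 : 0 < 1 / 2 - x := by linarith
  -- The cell index is chosen so that `2^(-k)` is comparable to the distance `s = 1/2 - x`: `6 s ≤
  -- 2^(-k) < 12 s`.
  obtain ⟨k, hk1, hk2⟩ : ∃ k : ℕ, (2 : ℝ) ^ k * (6 * (1 / 2 - x)) ≤ 1 ∧
      1 / 2 < (2 : ℝ) ^ k * (6 * (1 / 2 - x)) := by
    have := mem_dblCell_dblCount (y := 1 - 6 * (1 / 2 - x)) (by linarith) (by linarith)
    refine ⟨dblCount (1 - 6 * (1 / 2 - x)), ?_, ?_⟩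
    · have := this.1; linarith
    · have := this.2; linarith
  have h2k : (0 : ℝ) < 2 ^ k := by positivity
  set J := Set.Icc (1 - 1 / (2 : ℝ) ^ k) (1 - (1 - b) / 2 ^ k) with hJ
  have hJ' : ∀ y ∈ J, 0 ≤ 1 - (2 : ℝ) ^ k * (1 - y) ∧ 1 - (2 : ℝ) ^ k * (1 - y) ≤ b := by
    intro y hy
    have h1 : 1 - y ≤ 1 / 2 ^ k := by linarith [hy.1]
    have h2 : (1 - b) / 2 ^ k ≤ 1 - y := by linarith [hy.2]
    rw [le_div_iff₀ h2k] at h1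
    rw [div_le_iff₀ h2k] at h2
    constructor <;> linarith
  have hJs : ∀ y ∈ J, 1 - y < 12 * (1 / 2 - x) ∧ 3 * (1 / 2 - x) < 1 - y := by
    intro y hy
    obtain ⟨h1, h2⟩ := hJ' y hy
    constructor
    · by_contra! hlt
      nlinarith
    · by_contra! hlt
      nlinarith
  have hvol := volume_le_lsvMap (α := α) (ε := ε)
    (κ := 2 * (1 / 2 - x) / paretoPDFReal α ε 24) h0 h (by positivity)
    (measurableSet_Icc : MeasurableSet J) (fun y hy => by
      obtain ⟨h1, h2⟩ := hJs y hy
      refine ⟨by linarith, ?_⟩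
      -- Because `α < 1`, `f_α(x) ≥ x + 2x²`, which exceeds `1 - 3 (1/2 - x)`; the whole target is
      -- reachable.
      rw [lsvMap_of_lt h0.le h]
      have := Real.rpow_le_rpow_of_exponent_ge (by linarith : 0 < 2 * x) (by linarith) hα1.le
      rw [Real.rpow_one] at this
      nlinarith) (fun w hw hy => by
      have hw24 : w ≤ 24 := by
        by_contra! hlt
        have := lsvMap_lt_one_sub h hx hlt.le
        linarith [(hJs _ hy).1]
      have h3 := paretoPDFReal_anti hα hε hw hw24
      have h4 := neg_log_two_mul_le (by norm_num : (0 : ℝ) < 1 / 4) (by linarith) h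
      have h5 := lsvMap_lt_two_mul (hα.trans_le hw) h0 h
      calc (lsvMap w x - x) * -Real.log (2 * x) ≤ 1 / 2 * ((1 / 2 - x) / (1 / 4)) :=
            mul_le_mul (by linarith) h4 (neg_log_two_mul_pos h0 h).le (by norm_num)
        _ = 2 * (1 / 2 - x) / paretoPDFReal α ε 24 * paretoPDFReal α ε 24 := by
            field_simp; ring
        _ ≤ _ := by gcongr)
  have hsub : paretoMeasure α ε {a | lsvMap a x ∈ J} ≤
      paretoMeasure α ε {a | leftEntry (lsvMap a x) ≤ b} := by
    refine measure_mono fun a ha => ?_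
    obtain ⟨h1, h2⟩ := hJ' _ ha
    obtain ⟨h3, h4⟩ := hJs _ ha
    show leftEntry _ ≤ b
    rw [leftEntry_of_mem (k := k) (by linarith) (by linarith) ⟨h1, by linarith⟩]
    exact h2
  refine le_trans ?_ hsub
  have h6 : ENNReal.ofReal (6 * (1 / 2 - x) * b) ≤ volume J := by
    rw [hJ, Real.volume_Icc]
    refine ENNReal.ofReal_le_ofReal ?_
    have e : 1 - (1 - b) / 2 ^ k - (1 - 1 / 2 ^ k) = b / (2 : ℝ) ^ k := by field_simp; ring
    rw [e, le_div_iff₀ h2k]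
    nlinarith
  have h7 := h6.trans hvol
  have hκ : ENNReal.ofReal (2 * (1 / 2 - x) / paretoPDFReal α ε 24) ≠ 0 :=
    (ENNReal.ofReal_pos.2 (by positivity)).ne'
  have e : ENNReal.ofReal (6 * (1 / 2 - x) * b) =
      ENNReal.ofReal (2 * (1 / 2 - x) / paretoPDFReal α ε 24) *
        ENNReal.ofReal (3 * b * paretoPDFReal α ε 24) := by
    rw [← ENNReal.ofReal_mul (by positivity)]
    congr 1
    field_simp
    ring
  rw [e] at h7
  exact (ENNReal.mul_le_mul_iff_right hκ ENNReal.ofReal_ne_top).1 h7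

/-- From any point of `[b, 1/2)`, the next entry into `[0, 1/2)` is in `[0, b]` with a probability
bounded below. -/
theorem exists_le_measure_leftEntry (hα : 0 < α) (hα1 : α < 1) (hε : 0 < ε) {b : ℝ}
    (hb0 : 0 < b) (hb : b < 1 / 2) (hfb : (1 + b) / 2 < lsvMap α b) :
    ∃ p : ℝ≥0∞, 0 < p ∧ ∀ x, b ≤ x → x < 1 / 2 →
      p ≤ paretoMeasure α ε {a | leftEntry (lsvMap a x) ≤ b} := by
  obtain ⟨p, hp0, hp⟩ := exists_le_measure_leftEntry_near hα hα1 hε hb0 hb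
  obtain ⟨q, hq0, hq⟩ := exists_pos_le_measure_lsvMap hα hε
    (isCompact_Icc (a := b) (b := 1 / 2 - 1 / 48))
    (fun x hx => ⟨hb0.trans_le hx.1, hx.2.trans_lt (by norm_num)⟩)
    -- One doubling sends `(1/2, (1+b)/2)` onto `(0, b)`.
    (isOpen_Ioo (a := 1 / 2) (b := (1 + b) / 2)) (fun x hx => by
      have h0 : 0 < x := hb0.trans_le hx.1
      have h1 : x < 1 / 2 := hx.2.trans_lt (by norm_num)
      have h2 : lsvMap α b ≤ lsvMap α x := by
        rcases hx.1.eq_or_lt with h | h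
        · rw [h]
        · exact (lsvMap_lt_lsvMap hα hb0.le h h1).le
      obtain ⟨w, hw, hwx⟩ := (exists_lsvMap_eq (α := α) (y := 1 / 2 + b / 4) h0 h1
        (by linarith)).2 (by linarith)
      refine ⟨w, hw, ?_⟩
      rw [hwx]
      constructor <;> linarith)
  refine ⟨min p q, lt_min hp0 hq0, fun x hbx hx => ?_⟩
  rcases le_or_gt (1 / 2 - 1 / 48) x with h | h
  · exact (min_le_left _ _).trans (hp x h hx)
  · refine (min_le_right _ _).trans ((hq x ⟨hbx, h.le⟩).trans (measure_mono fun a ha => ?_))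
    obtain ⟨h1, h2⟩ : 1 / 2 < lsvMap a x ∧ lsvMap a x < (1 + b) / 2 := ha
    show leftEntry _ ≤ b
    rw [leftEntry_of_mem (k := 1) (by linarith) (by linarith)
      ⟨by linarith, by linarith⟩]
    linarith

/-! ### Elementary inequalities for the Lyapunov function -/

/-- A weaker singularity is absorbed by a stronger one plus a constant; `r` is the scale at which `M
s^(β-β') = 1`. -/
theorem exists_mul_rpow_neg_le {β β' M : ℝ} (hβ'0 : 0 < β') (hβ : β' < β) (hM : 0 < M) :
    ∃ D : ℝ, 0 < D ∧ ∀ s : ℝ, 0 < s → M * s ^ (-β') ≤ D + s ^ (-β) := by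
  set r := M ^ (-(1 / (β - β'))) with hr
  have hr0 : 0 < r := Real.rpow_pos_of_pos hM _
  refine ⟨M * r ^ (-β'), by positivity, fun s hs => ?_⟩
  rcases le_total s r with h | h
  · have h1 : M * s ^ (β - β') ≤ 1 := by
      have h2 := Real.rpow_le_rpow hs.le h (by linarith : 0 ≤ β - β')
      have h3 : r ^ (β - β') = M⁻¹ := by
        have : β - β' ≠ 0 := by linarith
        rw [hr, ← Real.rpow_mul hM.le, ← Real.rpow_neg_one]
        congr 1
        field_simp
      rw [h3] at h2
      calc M * s ^ (β - β') ≤ M * M⁻¹ := by gcongr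
        _ = 1 := mul_inv_cancel₀ hM.ne'
    have h4 : M * s ^ (-β') = M * s ^ (β - β') * s ^ (-β) := by
      rw [mul_assoc, ← Real.rpow_add hs]; ring_nf
    rw [h4]
    have h5 : 0 < s ^ (-β) := Real.rpow_pos_of_pos hs _
    have h6 : 0 < M * r ^ (-β') := by positivity
    nlinarith
  · have h1 : s ^ (-β') ≤ r ^ (-β') := Real.rpow_le_rpow_of_nonpos hr0 h (by linarith)
    have h2 : 0 < s ^ (-β) := Real.rpow_pos_of_pos hs _
    nlinarith

/-- Convexity of the power at `u/l` and `v/(1-l)`. With `l` near `1` the factor on `u^γ` is close to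
`1`, so a contraction survives. -/
theorem add_rpow_le_weighted {γ l u v : ℝ} (hγ : 1 < γ) (hl0 : 0 < l) (hl1 : l < 1)
    (hu : 0 ≤ u) (hv : 0 ≤ v) :
    (u + v) ^ γ ≤ l ^ (1 - γ) * u ^ γ + (1 - l) ^ (1 - γ) * v ^ γ := by
  have hl2 : 0 < 1 - l := by linarith
  have h := (convexOn_rpow hγ.le).2 (Set.mem_Ici.2 (div_nonneg hu hl0.le))
    (Set.mem_Ici.2 (div_nonneg hv hl2.le)) hl0.le hl2.le (by ring)
  simp only [smul_eq_mul] at h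
  rw [Real.div_rpow hu hl0.le, Real.div_rpow hv hl2.le, mul_div_cancel₀ _ hl0.ne',
    mul_div_cancel₀ _ hl2.ne'] at h
  rw [Real.rpow_sub hl0, Real.rpow_sub hl2, Real.rpow_one, Real.rpow_one]
  calc _ ≤ _ := h
    _ = _ := by ring

theorem exists_lyapunov_const {γ β β' p Λ M : ℝ} (hγ : 1 < γ) (hβ'0 : 0 < β') (hβ : β' < β)
    (hp0 : 0 < p) (hp1 : p ≤ 1) (hΛ : 0 < Λ) (hM : 0 < M) :
    ∃ A : ℝ, 0 < A ∧ ∀ s : ℝ, 0 < s →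
      Λ * s ^ (-(β' / γ)) + (A * (1 - p) + M * s ^ (-β')) ^ (1 / γ) ≤ (A + s ^ (-β)) ^ (1 / γ) := by
  have hγ0 : 0 < γ := by linarith
  -- This `l` makes `l^(1-γ) = 1/(1 - p/2)`, which turns the contraction `1 - p` into at most `1 -
  -- p/2`. The remaining fraction `A p/2 = D` pays for the lower-order singularities.
  set l := (1 - p / 2) ^ (1 / (γ - 1)) with hl
  have hp2 : 0 < 1 - p / 2 := by linarith
  have hl0 : 0 < l := Real.rpow_pos_of_pos hp2 _
  have hl1 : l < 1 := Real.rpow_lt_one hp2.le (by linarith)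
    (one_div_pos.2 (by linarith))
  have hl2 : 0 < 1 - l := by linarith
  have hlγ : l ^ (1 - γ) = (1 - p / 2)⁻¹ := by
    have : γ - 1 ≠ 0 := by linarith
    rw [hl, ← Real.rpow_mul hp2.le, ← Real.rpow_neg_one]
    congr 1
    field_simp
    ring
  have hM'' : 0 < (1 - p / 2)⁻¹ * M + (1 - l) ^ (1 - γ) * Λ ^ γ := by positivity
  obtain ⟨D, hD, HD⟩ := exists_mul_rpow_neg_le hβ'0 hβ hM''
  refine ⟨2 * D / p, by positivity, fun s hs => ?_⟩
  set A := 2 * D / p with hA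
  have hA0 : 0 < A := by positivity
  have hbase : 0 ≤ A * (1 - p) + M * s ^ (-β') :=
    add_nonneg (mul_nonneg hA0.le (by linarith)) (by positivity)
  simp only [one_div]
  rw [Real.le_rpow_inv_iff_of_pos (by positivity) (by positivity) hγ0, add_comm]
  refine (add_rpow_le_weighted hγ hl0 hl1 (by positivity) (by positivity)).trans ?_
  rw [← Real.rpow_mul hbase, inv_mul_cancel₀ hγ0.ne', Real.rpow_one,
    Real.mul_rpow hΛ.le (by positivity), ← Real.rpow_mul hs.le,
    show -(β' / γ) * γ = -β' by field_simp, hlγ]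
  have h1 : (1 - p / 2)⁻¹ * (1 - p) ≤ 1 - p / 2 := by
    rw [inv_mul_le_iff₀ hp2]
    nlinarith
  have h2 := HD s hs
  have h3 : A * (p / 2) = D := by rw [hA]; field_simp
  calc (1 - p / 2)⁻¹ * (A * (1 - p) + M * s ^ (-β')) + (1 - l) ^ (1 - γ) * (Λ ^ γ * s ^ (-β'))
      = A * ((1 - p / 2)⁻¹ * (1 - p)) +
        ((1 - p / 2)⁻¹ * M + (1 - l) ^ (1 - γ) * Λ ^ γ) * s ^ (-β') := by ring
    _ ≤ A * (1 - p / 2) + (D + s ^ (-β)) := by gcongr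
    _ = _ := by rw [← h3]; ring

theorem one_add_rpow_neg_le {β u : ℝ} (hβ0 : 0 < β) (hβ : β ≤ 1) (hu0 : 0 ≤ u) (hu : u ≤ 1) :
    (1 + u) ^ (-β) ≤ 1 - β / 4 * u := by
  have h1 : 1 + β / 2 * u ≤ (1 + u) ^ β := by
    rw [Real.rpow_def_of_pos (by linarith)]
    have h2 := Real.add_one_le_exp (Real.log (1 + u) * β)
    have h3 := Real.one_sub_inv_le_log_of_pos (by linarith : 0 < 1 + u)
    have h4 : u / 2 ≤ 1 - (1 + u)⁻¹ := by
      rw [le_sub_iff_add_le, ← le_sub_iff_add_le', inv_le_iff_one_le_mul₀ (by linarith)]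
      nlinarith
    nlinarith
  rw [Real.rpow_neg (by linarith)]
  have hv : 0 ≤ β * u := by positivity
  have hv1 : β * u ≤ 1 := by nlinarith
  refine (inv_anti₀ (by linarith) h1).trans ?_
  rw [inv_le_iff_one_le_mul₀ (by linarith)]
  nlinarith

/-! ### The Lyapunov function -/

/-- The Lyapunov function on the left branch, to the power `γ`: singular at the neutral fixed point
`0` and at the discontinuity `1/2`, and zero on `[c, b]`. -/
noncomputable def leftWeight (K A β b c z : ℝ) : ℝ≥0∞ :=
  if z < c then ENNReal.ofReal K * ENNReal.ofReal z ^ (-β)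
  else if z ≤ b then 0 else ENNReal.ofReal A + ENNReal.ofReal (1 / 2 - z) ^ (-β)

/-- The Lyapunov function. -/
noncomputable def lyapunov (γ K A β b c y : ℝ) : ℝ≥0∞ :=
  dblCount y + leftWeight K A β b c (leftEntry y) ^ (1 / γ)

variable {γ K A β b c : ℝ}

theorem measurable_leftWeight : Measurable (leftWeight K A β b c) := by
  unfold leftWeight
  refine Measurable.ite measurableSet_Iio (by fun_prop) ?_
  exact Measurable.ite measurableSet_Iic measurable_const (by fun_prop)

/-- The constant `A` is kept apart from the singular part: it is charged only above `b`, so its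
expectation contracts, and `A` can be chosen after the constant of the singular part. -/
theorem leftWeight_le (hK : 0 ≤ K) (z : ℝ) :
    leftWeight K A β b c z ≤
      (Set.Ioi b).indicator (fun _ => ENNReal.ofReal A) z +
        ENNReal.ofReal (K + 1) * endWeight β z := by
  unfold leftWeight endWeight
  rw [ENNReal.ofReal_add hK zero_le_one, ENNReal.ofReal_one]
  split_ifs with h1 h2
  · refine le_trans ?_ le_add_self
    gcongr
    · exact le_self_add
    · exact le_self_add
  · exact zero_le
  · rw [Set.indicator_of_mem (show z ∈ Set.Ioi b from not_le.1 h2)]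
    gcongr
    refine le_add_self.trans (le_mul_of_one_le_left zero_le le_add_self)

/-- Near the neutral fixed point, the chain leaves `[0, c)` through `[c, b]`. -/
theorem lyapunov_drift_left (hα : 0 < α) (hε : 0 < ε) (hγ : 1 < γ) (hαβ : α < β / γ) (hβ1 : β < 1)
    (hc1 : c < 1 / 2) (hcb : lsvMap α c = b) {p : ℝ}
    (hp0 : 0 < p) (hp : p = (paretoMeasure α ε (Set.Icc α (β / γ))).toReal)
    (hK : γ / (p * (β / 4)) ≤ K) {x : ℝ} (hx0 : 0 < x) (hxc : x < c) :
    1 + (∫⁻ a, (Set.Icc c b)ᶜ.indicator (fun y => lyapunov γ (K ^ γ) A β b c y ^ γ) (lsvMap a x)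
      ∂(paretoMeasure α ε)) ^ (1 / γ) ≤ lyapunov γ (K ^ γ) A β b c x := by
  have : IsProbabilityMeasure (paretoMeasure α ε) := isProbabilityMeasure_paretoMeasure hα hε
  have hγ0 : 0 < γ := by linarith
  have hβ0 : 0 < β := by
    by_contra! h
    have : β / γ ≤ 0 := div_nonpos_of_nonpos_of_nonneg h hγ0.le
    linarith
  have hx1 : x < 1 / 2 := hxc.trans hc1
  have hK0 : 0 < K := lt_of_lt_of_le (by positivity) hK
  have h2x0 : 0 < 2 * x := by linarith
  set v := β / 4 * (2 * x) ^ (β / γ) with hv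
  have hrp : (2 * x) ^ (β / γ) ≤ 1 := Real.rpow_le_one h2x0.le (by linarith) (by positivity)
  have hrp0 : 0 < (2 * x) ^ (β / γ) := Real.rpow_pos_of_pos h2x0 _
  have hv0 : 0 < v := by positivity
  have hv1 : v ≤ 1 := by nlinarith
  have hleft : ∀ y, 0 < y → y < c → lyapunov γ (K ^ γ) A β b c y =
      ENNReal.ofReal (K ^ γ * y ^ (-β)) ^ (1 / γ) := by
    intro y hy hyc
    rw [lyapunov, leftEntry_of_lt hy.le (hyc.trans hc1), dblCount_of_lt hy.le (hyc.trans hc1),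
      leftWeight, if_pos hyc, ENNReal.ofReal_rpow_of_pos hy, ENNReal.ofReal_mul (by positivity)]
    simp
  set D := K ^ γ * x ^ (-β) with hD
  have hD0 : 0 < D := by positivity
  set E := Set.Icc α (β / γ) with hE
  have hpt : ∀ᵐ a ∂(paretoMeasure α ε),
      (Set.Icc c b)ᶜ.indicator (fun y => lyapunov γ (K ^ γ) A β b c y ^ γ) (lsvMap a x) ≤
        E.indicator (fun _ => ENNReal.ofReal (D * (1 - v))) a +
          Eᶜ.indicator (fun _ => ENNReal.ofReal D) a := by
    filter_upwards [ae_le_paretoMeasure α ε] with a ha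
    have ha0 := hα.trans_le ha
    by_cases hC : lsvMap a x ∈ (Set.Icc c b)ᶜ
    · have hxy := lt_lsvMap (w := a) hx0 hx1
      -- No parameter can carry a point of `(0, c)` beyond `f_α(c) = b`.
      have hyb : lsvMap a x ≤ b := (lsvMap_anti_left hx0 hx1 ha).trans
        (hcb ▸ (lsvMap_lt_lsvMap hα hx0.le hxc hc1).le)
      have hyc : lsvMap a x < c := by
        by_contra! h
        exact hC ⟨h, hyb⟩
      rw [Set.indicator_of_mem hC, hleft _ (hx0.trans hxy) hyc, ← ENNReal.rpow_mul,
        one_div_mul_cancel hγ0.ne', ENNReal.rpow_one]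
      by_cases hEa : a ∈ E
      · rw [Set.indicator_of_mem hEa]
        refine le_trans (ENNReal.ofReal_le_ofReal ?_) le_self_add
        have h3 : (2 * x) ^ (β / γ) ≤ (2 * x) ^ a :=
          Real.rpow_le_rpow_of_exponent_ge h2x0 (by linarith) hEa.2
        have h4 : (2 * x) ^ a ≤ 1 := Real.rpow_le_one h2x0.le (by linarith) ha0.le
        have h5 := one_add_rpow_neg_le hβ0 hβ1.le (hrp0.le.trans h3) h4
        have e : lsvMap a x = x * (1 + (2 * x) ^ a) := by
          rw [lsvMap_of_lt hx0.le hx1]; ring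
        rw [e, Real.mul_rpow hx0.le (by linarith), ← mul_assoc]
        refine mul_le_mul_of_nonneg_left (h5.trans ?_) hD0.le
        have : v ≤ β / 4 * (2 * x) ^ a := by rw [hv]; gcongr
        linarith
      · rw [Set.indicator_of_mem (s := Eᶜ) hEa]
        refine le_trans (ENNReal.ofReal_le_ofReal ?_) le_add_self
        exact mul_le_mul_of_nonneg_left
          (Real.rpow_le_rpow_of_nonpos hx0 hxy.le (by linarith)) (by positivity)
    · rw [Set.indicator_of_notMem hC]
      exact zero_le
  have hEm : MeasurableSet E := measurableSet_Icc
  have hp1 : p ≤ 1 := by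
    rw [hp]
    exact ENNReal.toReal_le_of_le_ofReal zero_le_one (by simpa using prob_le_one)
  have hpE : paretoMeasure α ε E = ENNReal.ofReal p := by
    rw [hp, ENNReal.ofReal_toReal (measure_ne_top _ _)]
  have hpE' : paretoMeasure α ε Eᶜ = ENNReal.ofReal (1 - p) := by
    rw [prob_compl_eq_one_sub hEm, hpE, ENNReal.ofReal_sub _ hp0.le, ENNReal.ofReal_one]
  have hint : ∫⁻ a, (Set.Icc c b)ᶜ.indicator (fun y => lyapunov γ (K ^ γ) A β b c y ^ γ)
      (lsvMap a x) ∂(paretoMeasure α ε) ≤ ENNReal.ofReal (D * (1 - p * v)) := by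
    refine (lintegral_mono_ae hpt).trans (le_of_eq ?_)
    rw [lintegral_add_left (measurable_const.indicator hEm), lintegral_indicator_const hEm,
      lintegral_indicator_const hEm.compl, hpE, hpE',
      ← ENNReal.ofReal_mul (mul_nonneg hD0.le (by linarith)), ← ENNReal.ofReal_mul hD0.le,
      ← ENNReal.ofReal_add (mul_nonneg (mul_nonneg hD0.le (by linarith)) hp0.le)
        (mul_nonneg hD0.le (by linarith))]
    congr 1
    ring
  have hpv1 : p * v ≤ 1 := by nlinarith
  rw [hleft x hx0 hxc]
  calc _ ≤ 1 + ENNReal.ofReal (D * (1 - p * v)) ^ (1 / γ) := by gcongr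
    _ = ENNReal.ofReal (1 + (D * (1 - p * v)) ^ (1 / γ)) := by
        have h6 : 0 ≤ D * (1 - p * v) := mul_nonneg hD0.le (by linarith)
        rw [ENNReal.ofReal_rpow_of_nonneg h6 (by positivity),
          ENNReal.ofReal_add zero_le_one (by positivity), ENNReal.ofReal_one]
    _ ≤ ENNReal.ofReal (D ^ (1 / γ)) := by
        refine ENNReal.ofReal_le_ofReal ?_
        have h6 : (1 - p * v) ^ (1 / γ) ≤ 1 - 1 / γ * (p * v) := by
          have := rpow_one_add_le_one_add_mul_self (s := -(p * v)) (by linarith)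
            (p := 1 / γ) (by positivity) ((div_le_one hγ0).2 hγ.le)
          calc _ = (1 + -(p * v)) ^ (1 / γ) := by ring_nf
            _ ≤ _ := this
            _ = _ := by ring
        have h7 : D ^ (1 / γ) = K * x ^ (-(β / γ)) := by
          rw [hD, Real.mul_rpow (by positivity) (by positivity), ← Real.rpow_mul hK0.le,
            ← Real.rpow_mul hx0.le, mul_one_div_cancel hγ0.ne', Real.rpow_one]
          congr 2
          ring
        -- The factor `x^(-β/γ)` of the Lyapunov function cancels `x^(β/γ)` in `v`, so the gain does
        -- not depend on `x`; `K` is chosen to make it at least `1`.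
        have h8 : 1 ≤ D ^ (1 / γ) * (1 / γ * (p * v)) := by
          have e1 : v = β / 4 * (2 ^ (β / γ) * x ^ (β / γ)) := by
            rw [hv, Real.mul_rpow (by norm_num) hx0.le]
          have e2 : x ^ (-(β / γ)) * x ^ (β / γ) = 1 := by
            rw [← Real.rpow_add hx0]; simp
          have e3 : (1 : ℝ) ≤ 2 ^ (β / γ) := Real.one_le_rpow (by norm_num) (by positivity)
          have e4 : 1 ≤ K * (1 / γ * (p * (β / 4))) := by
            rw [div_le_iff₀ (by positivity)] at hK
            rw [show K * (1 / γ * (p * (β / 4))) = K * (p * (β / 4)) / γ by ring,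
              one_le_div hγ0]
            exact hK
          rw [h7, e1]
          calc (1 : ℝ) ≤ K * (1 / γ * (p * (β / 4))) * 2 ^ (β / γ) :=
                one_le_mul_of_one_le_of_one_le e4 e3
            _ = K * (1 / γ * (p * (β / 4))) * 2 ^ (β / γ) * (x ^ (-(β / γ)) * x ^ (β / γ)) := by
                rw [e2, mul_one]
            _ = _ := by ring
        rw [Real.mul_rpow hD0.le (by linarith)]
        have h9 : 0 < D ^ (1 / γ) := by positivity
        nlinarith
    _ = _ := by rw [ENNReal.ofReal_rpow_of_pos hD0]

/-- On the right branch the motion is deterministic. -/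
theorem lyapunov_drift_right (hα : 0 < α) (hε : 0 < ε) (hγ : 1 < γ) {x : ℝ} (hx0 : 1 / 2 ≤ x)
    (hx1 : x < 1) :
    1 + (∫⁻ a, (Set.Icc c b)ᶜ.indicator (fun y => lyapunov γ K A β b c y ^ γ) (lsvMap a x)
      ∂(paretoMeasure α ε)) ^ (1 / γ) ≤ lyapunov γ K A β b c x := by
  have : IsProbabilityMeasure (paretoMeasure α ε) := isProbabilityMeasure_paretoMeasure hα hε
  have hγ0 : 0 < γ := by linarith
  simp only [lsvMap_of_ge hx0]
  rw [lintegral_const, measure_univ, mul_one]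
  calc _ ≤ 1 + (lyapunov γ K A β b c (2 * x - 1) ^ γ) ^ (1 / γ) := by
        gcongr
        exact Set.indicator_le_self _ _ _
    _ = lyapunov γ K A β b c x := by
        rw [← ENNReal.rpow_mul, mul_one_div_cancel hγ0.ne', ENNReal.rpow_one, lyapunov, lyapunov,
          leftEntry_two_mul_sub_one hx0 hx1, dblCount_two_mul_sub_one hx0 hx1]
        push_cast
        ring

/-- One-step bound for the Lyapunov function from the left branch away from the fixed point. -/
theorem lintegral_lyapunov_le (hα : 0 < α) (hε : 0 < ε) (hγ : 1 < γ) (hK : 0 ≤ K)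
    {x : ℝ} (hx0 : 0 < x) (hx1 : x < 1 / 2) :
    (∫⁻ a, (Set.Icc c b)ᶜ.indicator (fun y => lyapunov γ K A β b c y ^ γ) (lsvMap a x)
      ∂(paretoMeasure α ε)) ^ (1 / γ) ≤
      dblCount (2 * x) + (ENNReal.ofReal A * paretoMeasure α ε {a | b < leftEntry (lsvMap a x)} +
        ENNReal.ofReal (K + 1) *
          ∫⁻ a, endWeight β (leftEntry (lsvMap a x)) ∂(paretoMeasure α ε)) ^ (1 / γ) := by
  have : IsProbabilityMeasure (paretoMeasure α ε) := isProbabilityMeasure_paretoMeasure hα hε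
  have hγ0 : 0 < γ := by linarith
  have hmy := measurable_leftEntry.comp (measurable_lsvMap_left x)
  have hm : Measurable fun a => leftWeight K A β b c (leftEntry (lsvMap a x)) :=
    measurable_leftWeight.comp hmy
  have hset : MeasurableSet {a | b < leftEntry (lsvMap a x)} := hmy measurableSet_Ioi
  calc _ ≤ (∫⁻ a, ((dblCount (2 * x) : ℝ≥0∞) +
        leftWeight K A β b c (leftEntry (lsvMap a x)) ^ (1 / γ)) ^ γ
          ∂(paretoMeasure α ε)) ^ (1 / γ) := by
        refine ENNReal.rpow_le_rpow (lintegral_mono_ae ?_) (by positivity)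
        filter_upwards [ae_le_paretoMeasure α ε] with a ha
        refine (Set.indicator_le_self _ _ _).trans ?_
        refine ENNReal.rpow_le_rpow ?_ hγ0.le
        simp only [lyapunov]
        gcongr
        exact dblCount_mono (lsvMap_lt_two_mul (hα.trans_le ha) hx0 hx1).le (by linarith)
    _ ≤ (∫⁻ _, (dblCount (2 * x) : ℝ≥0∞) ^ γ ∂(paretoMeasure α ε)) ^ (1 / γ) +
        (∫⁻ a, (leftWeight K A β b c (leftEntry (lsvMap a x)) ^ (1 / γ)) ^ γ
          ∂(paretoMeasure α ε)) ^ (1 / γ) :=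
        ENNReal.lintegral_Lp_add_le aemeasurable_const (hm.pow_const _).aemeasurable hγ.le
    _ ≤ _ := by
        rw [lintegral_const, measure_univ, mul_one, ← ENNReal.rpow_mul,
          mul_one_div_cancel hγ0.ne', ENNReal.rpow_one]
        simp only [← ENNReal.rpow_mul, one_div_mul_cancel hγ0.ne', ENNReal.rpow_one]
        gcongr
        calc _ ≤ ∫⁻ a, ({a | b < leftEntry (lsvMap a x)}.indicator (fun _ => ENNReal.ofReal A) a +
              ENNReal.ofReal (K + 1) * endWeight β (leftEntry (lsvMap a x)))
                ∂(paretoMeasure α ε) := lintegral_mono fun a => leftWeight_le hK _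
          _ = _ := by
              rw [lintegral_add_left (measurable_const.indicator hset),
                lintegral_indicator_const hset, lintegral_const_mul' _ _ ENNReal.ofReal_ne_top]

/-- The Lyapunov function satisfies the drift condition outside `[c, b]`, and its one-step
expectation is bounded on `[c, b]`. -/
theorem exists_lyapunov (hα : 0 < α) (hα1 : α < 1) (hε : 0 < ε) (hγ : 1 < γ) (hγα : γ < 1 / α)
    (hb : b < 1 / 2) (hfb : (1 + b) / 2 < lsvMap α b) (hc0 : 0 < c) (hc1 : c < 1 / 2)
    (hcb : lsvMap α c = b) :
    ∃ U : ℝ → ℝ≥0∞,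
      (∀ x ∈ Set.Icc (0 : ℝ) 1, x ∉ Set.Icc c b →
        1 + (∫⁻ a, (Set.Icc c b)ᶜ.indicator (fun y => U y ^ γ) (lsvMap a x)
          ∂(paretoMeasure α ε)) ^ (1 / γ) ≤ U x) ∧
      ∃ B : ℝ≥0∞, B < ⊤ ∧ ∀ x ∈ Set.Icc c b,
        (∫⁻ a, (Set.Icc c b)ᶜ.indicator (fun y => U y ^ γ) (lsvMap a x)
          ∂(paretoMeasure α ε)) ^ (1 / γ) ≤ B := by
  have : IsProbabilityMeasure (paretoMeasure α ε) := isProbabilityMeasure_paretoMeasure hα hε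
  have hγ0 : 0 < γ := by linarith
  have hcb' : c < b := hcb ▸ lt_lsvMap hc0 hc1
  have hb0 : 0 < b := hc0.trans hcb'
  have hαγ : α * γ < 1 := by rwa [lt_div_iff₀ hα, mul_comm] at hγα
  -- Here `γ < 1/α` enters: `β > αγ` gives the drift near `0`, `β < 1` gives integrability, and `β >
  -- 1 - ε` leaves room for `β'`.
  obtain ⟨β, hβl, hβ1⟩ : ∃ β : ℝ, max (α * γ) (1 - ε) < β ∧ β < 1 :=
    exists_between (max_lt hαγ (by linarith : 1 - ε < 1))
  have hβα : α * γ < β := (le_max_left _ _).trans_lt hβl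
  have hβε : 1 - ε < β := (le_max_right _ _).trans_lt hβl
  have hβ0 : 0 < β := lt_trans (by positivity) hβα
  have hαβ : α < β / γ := by rwa [lt_div_iff₀ hγ0]
  obtain ⟨β', hβ'l, hβ'β⟩ : ∃ β' : ℝ, max 0 (1 - ε) < β' ∧ β' < β :=
    exists_between (max_lt hβ0 hβε)
  have hβ'0 : 0 < β' := (le_max_left _ _).trans_lt hβ'l
  have hβ'ε : 1 - ε < β' := (le_max_right _ _).trans_lt hβ'l
  obtain ⟨M, hM, HM⟩ := exists_lintegral_endWeight_le hα hε hc0 hβ0 hβ1 hβ'0 hβ'ε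
  obtain ⟨Λ, hΛ, HΛ⟩ := exists_dblCount_le (δ := β' / γ) (by positivity)
  obtain ⟨p, hp0, hp1, Hp⟩ : ∃ p : ℝ, 0 < p ∧ p ≤ 1 ∧ ∀ x, b ≤ x → x < 1 / 2 →
      paretoMeasure α ε {a | b < leftEntry (lsvMap a x)} ≤ ENNReal.ofReal (1 - p) := by
    obtain ⟨q, hq0, hq⟩ := exists_le_measure_leftEntry hα hα1 hε hb0 hb hfb
    have hq1 : q ≤ 1 := (hq b le_rfl hb).trans prob_le_one
    have hqt : q ≠ ⊤ := (hq1.trans_lt ENNReal.one_lt_top).ne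
    refine ⟨q.toReal, ENNReal.toReal_pos hq0.ne' hqt,
      ENNReal.toReal_le_of_le_ofReal zero_le_one (by simpa using hq1), fun x hbx hx => ?_⟩
    have hm : MeasurableSet {a | leftEntry (lsvMap a x) ≤ b} :=
      (measurable_leftEntry.comp (measurable_lsvMap_left x)) measurableSet_Iic
    have e : {a | b < leftEntry (lsvMap a x)} = {a | leftEntry (lsvMap a x) ≤ b}ᶜ := by
      ext a
      exact (not_le (a := leftEntry (lsvMap a x)) (b := b)).symm
    rw [e, prob_compl_eq_one_sub hm, ENNReal.ofReal_sub _ ENNReal.toReal_nonneg,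
      ENNReal.ofReal_one, ENNReal.ofReal_toReal hqt]
    exact tsub_le_tsub_left (hq x hbx hx) 1
  set P := (paretoMeasure α ε (Set.Icc α (β / γ))).toReal with hP
  have hP0 : 0 < P := by
    refine ENNReal.toReal_pos (lt_of_lt_of_le (paretoMeasure_Ioo_pos hα hε le_rfl hαβ)
      (measure_mono Set.Ioo_subset_Icc_self)).ne' (measure_ne_top _ _)
  set K := γ / (P * (β / 4)) with hK
  have hK0 : 0 < K := by positivity
  have hKγ : 0 < K ^ γ := by positivity
  obtain ⟨A, hA, HA⟩ := exists_lyapunov_const (Λ := Λ) (M := (K ^ γ + 1) * M) hγ hβ'0 hβ'β hp0 hp1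
    hΛ (by positivity)
  have hend : ∀ x, c ≤ x → x < 1 / 2 → ENNReal.ofReal (K ^ γ + 1) *
      ∫⁻ a, endWeight β (leftEntry (lsvMap a x)) ∂(paretoMeasure α ε) ≤
        ENNReal.ofReal ((K ^ γ + 1) * M * (1 / 2 - x) ^ (-β')) := by
    intro x hcx hx
    rw [mul_assoc, ENNReal.ofReal_mul (by positivity)]
    gcongr
    exact HM x hcx hx
  refine ⟨lyapunov γ (K ^ γ) A β b c, fun x hx hxC => ?_, dblCount (2 * b) +
    (ENNReal.ofReal A + ENNReal.ofReal ((K ^ γ + 1) * M * (1 / 2 - b) ^ (-β'))) ^ (1 / γ), ?_,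
    fun x hx => ?_⟩
  · rcases lt_or_ge x (1 / 2) with hx2 | hx2
    · rcases lt_or_ge x c with hxc | hxc
      · rcases hx.1.eq_or_lt with rfl | hx0
        · rw [lyapunov, leftEntry_of_lt le_rfl (by norm_num), leftWeight, if_pos hc0,
            ENNReal.ofReal_zero, ENNReal.zero_rpow_of_neg (by linarith),
            ENNReal.mul_top (ENNReal.ofReal_pos.2 hKγ).ne', ENNReal.top_rpow_of_pos (by positivity)]
          simp
        · exact lyapunov_drift_left hα hε hγ hαβ hβ1 hc1 hcb hP0 hP le_rfl hx0 hxc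
      · have hxb : b < x := by
          by_contra! h
          exact hxC ⟨hxc, h⟩
        have hx0 := hb0.trans hxb
        have hs : 0 < 1 / 2 - x := by linarith
        have e : lyapunov γ (K ^ γ) A β b c x =
            ENNReal.ofReal ((A + (1 / 2 - x) ^ (-β)) ^ (1 / γ)) := by
          rw [lyapunov, leftEntry_of_lt hx0.le hx2, dblCount_of_lt hx0.le hx2, leftWeight,
            if_neg (not_lt.2 hxc), if_neg (not_le.2 hxb), ENNReal.ofReal_rpow_of_pos hs,
            ← ENNReal.ofReal_add hA.le (by positivity),
            ENNReal.ofReal_rpow_of_pos (by positivity)]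
          simp
        have hbase : 0 ≤ A * (1 - p) + (K ^ γ + 1) * M * (1 / 2 - x) ^ (-β') :=
          add_nonneg (mul_nonneg hA.le (by linarith)) (by positivity)
        rw [e]
        calc _ ≤ 1 + ((dblCount (2 * x) : ℝ≥0∞) +
              (ENNReal.ofReal A * ENNReal.ofReal (1 - p) +
                ENNReal.ofReal ((K ^ γ + 1) * M * (1 / 2 - x) ^ (-β'))) ^ (1 / γ)) := by
              refine add_le_add_right ((lintegral_lyapunov_le hα hε hγ hKγ.le hx0 hx2).trans ?_) 1
              gcongr
              · exact Hp x hxb.le hx2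
              · exact hend x hxc hx2
          _ = ENNReal.ofReal ((dblCount (2 * x) + 1) +
              (A * (1 - p) + (K ^ γ + 1) * M * (1 / 2 - x) ^ (-β')) ^ (1 / γ)) := by
              rw [← ENNReal.ofReal_mul hA.le, ← ENNReal.ofReal_add
                (mul_nonneg hA.le (by linarith)) (by positivity),
                ENNReal.ofReal_rpow_of_nonneg hbase (by positivity),
                ENNReal.ofReal_add (by positivity) (by positivity),
                ENNReal.ofReal_add (by positivity) zero_le_one, ENNReal.ofReal_natCast,
                ENNReal.ofReal_one]
              ring
          _ ≤ _ := by
              refine ENNReal.ofReal_le_ofReal (le_trans ?_ (HA (1 / 2 - x) hs))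
              gcongr
              exact HΛ x hx0.le hx2
    · rcases hx.2.eq_or_lt with rfl | hx3
      · have e : lyapunov γ (K ^ γ) A β b c 1 = ⊤ := by
          have e1 : leftEntry 1 = 1 := by rw [leftEntry]; simp
          rw [lyapunov, e1, leftWeight, if_neg (by linarith), if_neg (by linarith),
            ENNReal.ofReal_of_nonpos (by norm_num : (1 / 2 : ℝ) - 1 ≤ 0),
            ENNReal.zero_rpow_of_neg (by linarith), add_top,
            ENNReal.top_rpow_of_pos (by positivity), add_top]
        rw [e]
        exact le_top
      · exact lyapunov_drift_right hα hε hγ hx2 hx3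
  · refine ENNReal.add_lt_top.2 ⟨ENNReal.natCast_lt_top _, ?_⟩
    exact ENNReal.rpow_lt_top_of_nonneg (by positivity)
      (ENNReal.add_ne_top.2 ⟨ENNReal.ofReal_ne_top, ENNReal.ofReal_ne_top⟩)
  · have hx0 := hc0.trans_le hx.1
    have hx2 := hx.2.trans_lt hb
    refine (lintegral_lyapunov_le hα hε hγ hKγ.le hx0 hx2).trans ?_
    gcongr
    · exact dblCount_mono (by linarith [hx.2]) (by linarith)
    · exact mul_le_of_le_one_right zero_le prob_le_one
    · refine (hend x hx.1 hx2).trans (ENNReal.ofReal_le_ofReal ?_)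
      have : (1 / 2 - x) ^ (-β') ≤ (1 / 2 - b) ^ (-β') :=
        Real.rpow_le_rpow_of_nonpos (by linarith) (by linarith [hx.2]) (by linarith)
      gcongr

theorem mainTheorem8 (α ε b c γ : ℝ) (hα0 : 0 < α) (hα1 : α < 1) (hε : 0 < ε)
    (hb0 : 0 < b) (hb : b < 1 / 2) (hfb : (3 + b) / 4 < lsvMap α b)
    -- `c` is the preimage of `b` under the left branch of `f_α`
    (hc : c ∈ Set.Ico (0 : ℝ) (1 / 2)) (hcb : lsvMap α c = b)
    (hγ1 : 1 < γ) (hγα : γ < 1 / α) :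
    IsPetite α ε (Set.Icc c b) ∧
    (⨆ x ∈ Set.Icc c b,
      ∫⁻ w, ((returnTime (Set.Icc c b) w x : ℕ∞) : ℝ≥0∞) ^ γ ∂(paramLaw α ε)) < ⊤ ∧
    IsSubgeometricRate (fun n : ℕ => (n : ℝ) ^ (γ - 1)) ∧
    (⨆ x ∈ Set.Icc c b,
      ∫⁻ w, sumUpTo (fun n : ℕ => (n : ℝ) ^ (γ - 1)) (returnTime (Set.Icc c b) w x)
        ∂(paramLaw α ε)) < ⊤ := by
  have hc0 : 0 < c := by
    rcases hc.1.eq_or_lt with rfl | h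
    · rw [lsvMap_of_lt le_rfl (by norm_num)] at hcb
      linarith
    · exact h
  obtain ⟨U, hU, B, hB, hUB⟩ := exists_lyapunov hα0 hα1 hε hγ1 hγα hb (by linarith) hc0 hc.2 hcb
  have hτ : ∀ x ∈ Set.Icc c b,
      ∫⁻ w, ((returnTime (Set.Icc c b) w x : ℕ∞) : ℝ≥0∞) ^ γ ∂(paramLaw α ε) ≤ (1 + B) ^ γ := by
    intro x hx
    refine (lintegral_returnTime_le hα0 hε hγ1.le measurableSet_Icc hU
      ⟨hc0.le.trans hx.1, by linarith [hx.2]⟩).trans ?_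
    gcongr
    exact hUB x hx
  have hfin : (1 + B) ^ γ < ⊤ := ENNReal.rpow_lt_top_of_nonneg (by linarith)
    (ENNReal.add_ne_top.2 ⟨ENNReal.one_ne_top, hB.ne⟩)
  refine ⟨isPetite_Icc hα0 hε hb0 hb (by linarith) hc0 hc.2 hcb,
    (iSup₂_le hτ).trans_lt hfin, isSubgeometricRate_rpow (by linarith), ?_⟩
  refine (iSup₂_le fun x hx => (lintegral_mono fun w => ?_).trans (hτ x hx)).trans_lt hfin
  exact sumUpTo_rpow_le hγ1 _
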